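/- Let $A$ be an Artinian local ring, and let $B=\bigoplus_{\nu\in\mathbb N^r}[B]_\nu$ be a finitely generated standard $\mathbb N^r$-graded $A$-algebra, i.e. $[B]_{\mathbf 0}=A$ and $B$ is generated over $A$ by finitely many elements, each of degree $\mathbf e_i$ for some $1\le i\le r$. Let $N=\bigoplus_{\nu_1>0,\dots,\nu_r>0}[B]_\nu$ be the irrelevant ideal. Let $M=\bigoplus_{\nu\in\mathbb Z^r}[M]_\nu$ be a finitely generated $\mathbb Z^r$-graded $B$-module and $d=\dim M$ (with $\dim 0=-\infty$). For $\nu\in\mathbb Z^r$ write $|\nu|=\nu_1+\cdots+\nu_r$, $\mathbf t^\nu=t_1^{\nu_1}\cdots t_r^{\nu_r}$ and $(\mathbf 1-\mathbf t)^\nu=(1-t_1)^{\nu_1}\cdots(1-t_r)^{\nu_r}$; inequalities between vectors are componentwise, and $\mathbf 1=(1,\dots,1)$. The Hilbert series of $M$ has a decomposition $$\sum_{\nu\in\mathbb Z^r}\operatorname{length}_A([M]_\nu)\,\mathbf t^\nu=\sum_{\mathbf n\in\mathbb N^r,\ |\mathbf n|=d}\frac{Q_{\mathbf n}(\mathbf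 t)}{(\mathbf 1-\mathbf t)^{\mathbf n}},\qquad Q_{\mathbf n}\in\mathbb Z[\mathbf t,\mathbf t^{-1}],$$ and the integers $Q_{\mathbf n}(\mathbf 1)$ do not depend on the decomposition. Hence the mixed multiplicities of $M$ are well defined: for $\mathbf n\in\mathbb Z^r$ with $\mathbf n\ge-\mathbf 1$ and $|\mathbf n+\mathbf 1|\ge d$, put $e_{\mathbf n}(M)=Q_{\mathbf n+\mathbf 1}(\mathbf 1)$ if $|\mathbf n+\mathbf 1|=d$, and $e_{\mathbf n}(M)=0$ if $|\mathbf n+\mathbf 1|>d$. Let $M^{\mathrm{gr}}$ be $M$ with the $\mathbb Z$-grading $[M^{\mathrm{gr}}]_k=\bigoplus_{|\nu|=k}[M]_\nu$, and let $e(M^{\mathrm{gr}})$ be its multiplicity: $(d-1)!$ times the coefficient of $X^{d-1}$ in the Hilbert polynomial of $M^{\mathrm{gr}}$ if $d\ge1$, and $\operatorname{length}_A(M)$ if $d\le 0$. Then: (i) $\displaystyle e(M^{\mathrm{gr}})=\sum_{\mathbf n\ge-\mathbf 1,\ |\mathbf n+\mathbf 1|=d}e_{\mathbf n}(M)$. (ii)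 There is some $\mathbf n\in\mathbb Z^r$ with $\mathbf n\ge-\mathbf 1$, $|\mathbf n+\mathbf 1|\ge d$, $\mathbf n\not\ge\mathbf 0$ and $e_{\mathbf n}(M)>0$ if and only if there is a prime $\mathfrak p\in\operatorname{Supp}(M)$ with $\dim(B/\mathfrak p)=d$ and $\mathfrak p\supseteq N$. -/

import Mathlib

noncomputable section

/-- `𝓑` is a standard `ℕ^r`-grading of the finitely generated `A`-algebra `B`: the degree zero part
of `B` is `A`, and `B` is generated over `A` by finitely many elements, each of which is
homogeneous of degree `e_i` for some `i`. -/
structure IsStandardMultigraded {A B : Type*} [CommRing A] [CommRing B] [Algebra A B] {r : ℕ}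
    (𝓑 : (Fin r → ℕ) → Submodule A B) : Prop where
  algebraMap_injective : Function.Injective (algebraMap A B)
  degree_zero : ∀ b : B, b ∈ 𝓑 0 ↔ ∃ a : A, algebraMap A B a = b
  generated : ∃ S : Finset B,
    (∀ x ∈ S, ∃ i : Fin r, x ∈ 𝓑 (Pi.single i 1)) ∧ Algebra.adjoin A (S : Set B) = ⊤

/-- `ℳ` is a `ℤ^r`-grading of the `B`-module `M`: `M` is the direct sum of the `ℳ ν`, and
`[B]_μ · [M]_ν ⊆ [M]_{μ+ν}`. -/
structure IsMultigradedModule {A B M : Type*} [CommRing A] [CommRing B] [Algebra A B]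
    [AddCommGroup M] [Module A M] [Module B M] {r : ℕ}
    (𝓑 : (Fin r → ℕ) → Submodule A B) (ℳ : (Fin r → ℤ) → Submodule A M) : Prop where
  isInternal : DirectSum.IsInternal ℳ
  smul_mem : ∀ (μ : Fin r → ℕ) (ν : Fin r → ℤ) (b : B) (m : M),
    b ∈ 𝓑 μ → m ∈ ℳ ν → b • m ∈ ℳ (fun i => (μ i : ℤ) + ν i)

/-- The irrelevant ideal `⨁_{ν > 0} [B]_ν`, where `ν > 0` means that all `ν_i > 0`. -/
def irrelevantIdeal {A B : Type*} [CommRing A] [CommRing B] [Algebra A B] {r : ℕ}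
    (𝓑 : (Fin r → ℕ) → Submodule A B) : Ideal B :=
  Ideal.span {b : B | ∃ ν : Fin r → ℕ, (∀ i, 0 < ν i) ∧ b ∈ 𝓑 ν}

/-- The Hilbert function `ν ↦ length_A [M]_ν`, that is, the coefficients of the Hilbert series.
(For a finitely generated graded module over a standard multigraded algebra over an Artinian ring
all these lengths are finite.) -/
def hilbertFunction {A M : Type*} [CommRing A] [AddCommGroup M] [Module A M] {ι : Type*}
    (ℳ : ι → Submodule A M) (ν : ι) : ℕ :=
  (Module.length A (ℳ ν)).toNat

/-- Laurent polynomials `ℤ[t_1^{±1}, …, t_r^{±1}]`. -/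
abbrev MultiLaurent (r : ℕ) : Type := AddMonoidAlgebra ℤ (Fin r → ℤ)

/-- The value `Q(1, …, 1)`. -/
def MultiLaurent.evalOne {r : ℕ} (Q : MultiLaurent r) : ℤ :=
  Q.coeff.sum fun _ a => a

/-- The coefficient of `t ^ k` in the expansion of `1 / (1 - t) ^ n` (which is `0` for `k < 0`). -/
def invOneSubCoeff (n : ℕ) (k : ℤ) : ℤ :=
  if 0 ≤ k then PowerSeries.coeff k.toNat (PowerSeries.invOneSubPow ℤ n).val else 0

/-- The coefficient of `t ^ ν` in the expansion of
`Q(t) / ((1 - t_1) ^ n_1 ⋯ (1 - t_r) ^ n_r)` in `ℤ[[t]][t⁻¹]`. -/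
def fractionCoeff {r : ℕ} (Q : MultiLaurent r) (n : Fin r → ℕ) (ν : Fin r → ℤ) : ℤ :=
  Q.coeff.sum fun μ a => a * ∏ i, invOneSubCoeff (n i) (ν i - μ i)

lemma finite_weight_eq (r : ℕ) (d : WithBot ℕ∞) :
    {n : Fin r → ℕ | ((∑ i, n i : ℕ) : WithBot ℕ∞) = d}.Finite := by
  rcases Set.eq_empty_or_nonempty {n : Fin r → ℕ | ((∑ i, n i : ℕ) : WithBot ℕ∞) = d} with h | h
  · rw [h]
    exact Set.finite_empty
  · obtain ⟨m, hm⟩ := h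
    refine (Set.finite_Iic (fun _ : Fin r => ∑ i, m i)).subset fun n hn i => ?_
    have h1 : ((∑ i, n i : ℕ) : WithBot ℕ∞) = ((∑ i, m i : ℕ) : WithBot ℕ∞) :=
      Eq.trans hn (Eq.symm hm)
    have h2 : ∑ i, n i = ∑ i, m i := by exact_mod_cast h1
    exact h2 ▸ Finset.single_le_sum (f := n) (fun _ _ => Nat.zero_le _) (Finset.mem_univ i)

/-- The finite set of all `n ∈ ℕ^r` with `|n| = d`; it is empty for `d = ⊥ = dim 0`. -/
def weightSet (r : ℕ) (d : WithBot ℕ∞) : Finset (Fin r → ℕ) :=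
  (finite_weight_eq r d).toFinset

/-- The finite set of all `n ∈ ℤ^r` with `n ≥ -1` and `|n + 1| = d`
(see `mem_mixedTypes`). -/
def mixedTypes (r : ℕ) (d : WithBot ℕ∞) : Finset (Fin r → ℤ) :=
  (weightSet r d).image fun n i => (n i : ℤ) - 1

/-- For `n ≥ -1` this is the vector `n + 1` of natural numbers. -/
def shiftOne {r : ℕ} (n : Fin r → ℤ) : Fin r → ℕ := fun i => (n i + 1).toNat

lemma mem_weightSet {r : ℕ} {d : WithBot ℕ∞} {n : Fin r → ℕ} :
    n ∈ weightSet r d ↔ ((∑ i, n i : ℕ) : WithBot ℕ∞) = d := by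
  simp [weightSet]

lemma mem_mixedTypes {r : ℕ} {d : WithBot ℕ∞} {n : Fin r → ℤ} :
    n ∈ mixedTypes r d ↔
      (∀ i, -1 ≤ n i) ∧ ((∑ i, shiftOne n i : ℕ) : WithBot ℕ∞) = d := by
  simp only [mixedTypes, Finset.mem_image, mem_weightSet]
  constructor
  · rintro ⟨m, hm, rfl⟩
    exact ⟨fun i => by dsimp only; omega, by simpa [shiftOne] using hm⟩
  · rintro ⟨h, hd⟩
    refine ⟨shiftOne n, hd, funext fun i => ?_⟩
    have := h i
    simp only [shiftOne]
    omega

/-- The family `Q` of Laurent polynomials satisfies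
`Hilb_M(t) = ∑_{n ∈ ℕ^r, |n| = d} Q_n(t) / (1 - t) ^ n` with `d = dim M`. -/
def IsHilbertDecomposition {A M : Type*} (B : Type*) [CommRing A] [CommRing B]
    [AddCommGroup M] [Module A M] [Module B M] {r : ℕ}
    (ℳ : (Fin r → ℤ) → Submodule A M) (Q : (Fin r → ℕ) → MultiLaurent r) : Prop :=
  ∀ ν : Fin r → ℤ, (hilbertFunction ℳ ν : ℤ) =
    ∑ n ∈ weightSet r (Module.supportDim B M), fractionCoeff (Q n) n ν

open Classical in
/-- The mixed multiplicity `e_n(M)`, for `n ≥ -1` with `|n + 1| ≥ dim M`: choose any decomposition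
`Hilb_M(t) = ∑_{|n| = dim M} Q_n(t) / (1 - t) ^ n`; then `e_n(M) = Q_{n+1}(1, …, 1)` if
`|n + 1| = dim M`, and `e_n(M) = 0` if `|n + 1| > dim M`. -/
def mixedMultiplicity {A M : Type*} (B : Type*) [CommRing A] [CommRing B]
    [AddCommGroup M] [Module A M] [Module B M] {r : ℕ}
    (ℳ : (Fin r → ℤ) → Submodule A M) (n : Fin r → ℤ) : ℤ :=
  if h : (∃ Q, IsHilbertDecomposition B ℳ Q) ∧ n ∈ mixedTypes r (Module.supportDim B M) then
    (h.1.choose (shiftOne n)).evalOne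
  else 0

/-- The single grading of `M^gr`: its part of degree `k` is `⨁_{|ν| = k} [M]_ν`. -/
def totalGrading {A M : Type*} [CommRing A] [AddCommGroup M] [Module A M] {r : ℕ}
    (ℳ : (Fin r → ℤ) → Submodule A M) (k : ℤ) : Submodule A M :=
  ⨆ ν : {ν : Fin r → ℤ // ∑ i, ν i = k}, ℳ ν

/-- `P` is the Hilbert polynomial of the `ℤ`-graded module with graded parts `𝒩 k`. -/
def IsHilbertPolynomial {A M : Type*} [CommRing A] [AddCommGroup M] [Module A M]
    (𝒩 : ℤ → Submodule A M) (P : Polynomial ℚ) : Prop :=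
  ∀ᶠ k : ℤ in Filter.atTop, (hilbertFunction 𝒩 k : ℚ) = P.eval (k : ℚ)

open Classical in
/-- The multiplicity of a `ℤ`-graded `B`-module `M` with graded parts `𝒩 k`, of dimension `d`:
it is `length_A M` if `d ≤ 0` (where `M = 0` has multiplicity `0`), and otherwise it is `(d - 1)!`
times the coefficient of degree `d - 1` of the Hilbert polynomial. -/
def gradedMultiplicity {A M : Type*} (B : Type*) [CommRing A] [CommRing B]
    [AddCommGroup M] [Module A M] [Module B M] (𝒩 : ℤ → Submodule A M) : ℚ :=
  if Module.supportDim B M ≤ 0 then ((Module.length A M).toNat : ℚ)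
  else if h : ∃ P, IsHilbertPolynomial 𝒩 P then
    let d : ℕ := ((Module.supportDim B M).unbotD 0).toNat
    ((d - 1).factorial : ℚ) * h.choose.coeff (d - 1)
  else 0

end

/-!
Prime filtrations reduce all assertions to quotients `B ⧸ P` by homogeneous primes, where the
coefficients `Q_n(1)` are computed by induction; a comparison of growth identifies the weight `|n|`
with the Krull dimension.

*Decompositions.* Say that a function `H` on `ℤ^r` has poles of weight `d` with leading form `E`
(`HasPoles d H E`) if it is the coefficient function of `∑_{|n| = d} Q_n / (1 - t) ^ n` with
`Q_n(1) = E n`. The leading form is unique (`HasPoles.unique`): after multiplication by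
`∏ (1 - t_i) ^ d` and the substitution `t_i = 1 + X_i`, the number `± Q_n(1)` is the coefficient of
`X ^ (d - n)` in a power series that does not depend on the decomposition. If
`H(ν) - H(ν - e_i)` has poles of weight `d` and leading form `E`, then `H` has poles of weight
`d + 1`, and its leading form is `E` shifted by `e_i` (`HasPoles.of_sub_translate`).

*Prime filtrations.* Maximal elements among the annihilators of homogeneous elements are homogeneous
primes, so that a multigraded module has a filtration with factors `(B ⧸ P_j)(-ν_j)`
(`exists_prime_filtration`); the dimension of the module is the maximum of the `dim B ⧸ P_j`, and
its leading form is the sum of those of the factors of maximal dimension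
(`exists_hasPoles_of_list`).

*Primes.* The case `M = B ⧸ P` is treated by noetherian induction on `P` (`exists_isLeadingForm`).
If `P` contains all `[B]_{e_i}`, then `B ⧸ P` is a field, with Hilbert series `1`. Otherwise let
`x ∈ [B]_{e_i}` be outside `P`. Multiplication by `x` on `B ⧸ P` shows that the leading form of
`B ⧸ P` is that of `B ⧸ (P + x B)` shifted by `e_i`, and the prime filtration of `B ⧸ (P + x B)`
only involves primes containing `P` properly. So the leading form is nonnegative, it is not zero,
and `E n > 0` forces `n_i > 0`. As the leading form is unique, `i` can be any index with
`[B]_{e_i} ⊄ P`, and hence `E n > 0` forces `n_i = 0` exactly for the indices `i` with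
`[B]_{e_i} ⊆ P`; there are such indices if and only if `P` contains the irrelevant ideal. This
gives the second assertion.

The induction needs that the weight is the dimension of `B ⧸ P`. It is at most the dimension,
because a chain of primes over `P + x B` can be prolonged by `P`. It is at least the dimension by
comparison of growth (`coheight_le_of_hasPoles`): the length of the image in `B ⧸ P` of the part of
`B` with degrees in `[0, k] ^ r` is at most of order `k ^ d` if the Hilbert function has poles of
weight `d`, and at least of order `k ^ l` if there is a chain of primes `P = q_0 < ⋯ < q_l`, since
for `q < q'` multiplication by an element of `q'` outside `q` embeds `B ⧸ q` into the kernel of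
`B ⧸ q → B ⧸ q'`.

*The total grading.* Putting `t_i = t` for all `i` in a decomposition gives
`∑ Q_n(t, …, t) / (1 - t) ^ d`, whose value of the numerator at `1` is the sum of all `E n`
(`gradedMultiplicity_totalGrading_eq`).
-/

noncomputable section

/-! ### The Laurent ring acting on functions on `ℤ^r` -/

lemma mem_weightSet_natCast {r d : ℕ} {n : Fin r → ℕ} :
    n ∈ weightSet r (d : WithBot ℕ∞) ↔ ∑ i, n i = d := by
  rw [mem_weightSet]
  exact ⟨fun h => by exact_mod_cast h, fun h => by exact_mod_cast h⟩

lemma invOneSubCoeff_of_neg {n : ℕ} {k : ℤ} (hk : k < 0) : invOneSubCoeff n k = 0 :=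
  if_neg (not_le.mpr hk)

lemma invOneSubCoeff_natCast (n k : ℕ) :
    invOneSubCoeff n (k : ℤ) = PowerSeries.coeff k (PowerSeries.invOneSubPow ℤ n).val := by
  simp [invOneSubCoeff]

lemma invOneSubCoeff_zero (k : ℤ) : invOneSubCoeff 0 k = if k = 0 then 1 else 0 := by
  rcases lt_or_ge k 0 with hk | hk
  · rw [invOneSubCoeff_of_neg hk, if_neg hk.ne]
  · lift k to ℕ using hk
    rw [invOneSubCoeff_natCast, PowerSeries.invOneSubPow_zero, Units.val_one, PowerSeries.coeff_one]
    simp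

lemma invOneSubCoeff_succ_sub (n : ℕ) (k : ℤ) :
    invOneSubCoeff (n + 1) k - invOneSubCoeff (n + 1) (k - 1) = invOneSubCoeff n k := by
  rcases lt_or_ge k 0 with hk | hk
  · rw [invOneSubCoeff_of_neg hk, invOneSubCoeff_of_neg hk, invOneSubCoeff_of_neg (by omega),
      sub_zero]
  · lift k to ℕ using hk
    have h := PowerSeries.one_sub_pow_mul_invOneSubPow_val_add_eq_invOneSubPow_val ℤ n 1
    rw [pow_one, sub_mul, one_mul] at h
    have h' := congrArg (PowerSeries.coeff k) h
    rw [map_sub] at h'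
    rw [invOneSubCoeff_natCast, invOneSubCoeff_natCast, ← h']
    congr 1
    cases k with
    | zero => simp [invOneSubCoeff]
    | succ k =>
      rw [PowerSeries.coeff_succ_X_mul, ← invOneSubCoeff_natCast]
      congr 1
      push_cast
      ring

/-- The coefficient of `t ^ ν` in the expansion of `1 / (1 - t) ^ n`. -/
def poleCoeff {r : ℕ} (n : Fin r → ℕ) (ν : Fin r → ℤ) : ℤ :=
  ∏ i, invOneSubCoeff (n i) (ν i)

/-- Multiplication by Laurent polynomials, on coefficient functions of formal series: the monomial
`t ^ μ` acts by translation by `μ`. -/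
def laurentAct (r : ℕ) :
    MultiLaurent r →ₐ[ℤ] Module.End ℤ ((Fin r → ℤ) → ℤ) :=
  AddMonoidAlgebra.lift ℤ _ _
    { toFun := fun μ => LinearMap.funLeft ℤ ℤ fun ν => ν - μ.toAdd
      map_one' := by
        ext f ν
        simp [LinearMap.funLeft_apply]
      map_mul' := fun μ μ' => by
        ext f ν
        simp [LinearMap.funLeft_apply, sub_sub] }

lemma laurentAct_apply {r : ℕ} (Q : MultiLaurent r) (H : (Fin r → ℤ) → ℤ) (ν : Fin r → ℤ) :
    laurentAct r Q H ν = Q.coeff.sum fun μ a => a * H (ν - μ) := by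
  rw [laurentAct, AddMonoidAlgebra.lift_apply]
  simp [Finsupp.sum, LinearMap.funLeft_apply]

lemma laurentAct_single {r : ℕ} (μ : Fin r → ℤ) (H : (Fin r → ℤ) → ℤ) (ν : Fin r → ℤ) :
    laurentAct r (AddMonoidAlgebra.single μ 1) H ν = H (ν - μ) := by
  rw [laurentAct_apply]
  simp

lemma fractionCoeff_eq {r : ℕ} (Q : MultiLaurent r) (n : Fin r → ℕ) :
    fractionCoeff Q n = laurentAct r Q (poleCoeff n) := by
  funext ν
  rw [laurentAct_apply]
  rfl

/-- The element `1 - t_i` of the Laurent ring. -/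
def oneSubVar {r : ℕ} (i : Fin r) : MultiLaurent r :=
  1 - AddMonoidAlgebra.single (Pi.single i 1) 1

lemma laurentAct_oneSubVar {r : ℕ} (i : Fin r) (H : (Fin r → ℤ) → ℤ) (ν : Fin r → ℤ) :
    laurentAct r (oneSubVar i) H ν = H ν - H (ν - Pi.single i 1) := by
  rw [oneSubVar, map_sub, map_one, LinearMap.sub_apply, Pi.sub_apply, laurentAct_single]
  rfl

lemma laurentAct_oneSubVar_poleCoeff {r : ℕ} (i : Fin r) (n : Fin r → ℕ) :
    laurentAct r (oneSubVar i) (poleCoeff (n + Pi.single i 1)) = poleCoeff n := by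
  funext ν
  rw [laurentAct_oneSubVar]
  simp only [poleCoeff]
  rw [← Finset.mul_prod_erase _ _ (Finset.mem_univ i),
    ← Finset.mul_prod_erase _ _ (Finset.mem_univ i),
    ← Finset.mul_prod_erase _ _ (Finset.mem_univ i)]
  have h1 : ∏ j ∈ Finset.univ.erase i, invOneSubCoeff ((n + Pi.single i 1 : Fin r → ℕ) j) (ν j) =
      ∏ j ∈ Finset.univ.erase i, invOneSubCoeff (n j) (ν j) :=
    Finset.prod_congr rfl fun j hj => by simp [Finset.ne_of_mem_erase hj]
  have h2 : ∏ j ∈ Finset.univ.erase i,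
      invOneSubCoeff ((n + Pi.single i 1 : Fin r → ℕ) j) ((ν - Pi.single i 1 : Fin r → ℤ) j) =
      ∏ j ∈ Finset.univ.erase i, invOneSubCoeff (n j) (ν j) :=
    Finset.prod_congr rfl fun j hj => by simp [Finset.ne_of_mem_erase hj]
  rw [h1, h2, ← sub_mul]
  simp [invOneSubCoeff_succ_sub]

lemma poleCoeff_eq_zero {r : ℕ} {n : Fin r → ℕ} {ν : Fin r → ℤ} {i : Fin r} (h : ν i < 0) :
    poleCoeff n ν = 0 :=
  Finset.prod_eq_zero (Finset.mem_univ i) (invOneSubCoeff_of_neg h)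

lemma poleCoeff_zero {r : ℕ} (ν : Fin r → ℤ) : poleCoeff 0 ν = if ν = 0 then 1 else 0 := by
  simp only [poleCoeff, Pi.zero_apply, invOneSubCoeff_zero]
  rw [Finset.prod_ite_zero]
  simp [funext_iff]

lemma laurentAct_poleCoeff_zero {r : ℕ} (Q : MultiLaurent r) :
    laurentAct r Q (poleCoeff 0) = Q.coeff := by
  funext ν
  rw [laurentAct_apply]
  simp only [poleCoeff_zero, sub_eq_zero, mul_ite, mul_one, mul_zero]
  rw [Finsupp.sum_ite_eq]
  split_ifs with h
  · rfl
  · exact (Finsupp.notMem_support_iff.mp h).symm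

/-- The evaluation of Laurent polynomials at `t = 1`, as a ring homomorphism. -/
def evalOneHom (r : ℕ) : MultiLaurent r →ₐ[ℤ] ℤ :=
  AddMonoidAlgebra.lift ℤ _ _ 1

lemma evalOne_eq {r : ℕ} (Q : MultiLaurent r) : Q.evalOne = evalOneHom r Q := by
  rw [evalOneHom, AddMonoidAlgebra.lift_apply]
  simp [MultiLaurent.evalOne]

lemma evalOneHom_single {r : ℕ} (μ : Fin r → ℤ) :
    evalOneHom r (AddMonoidAlgebra.single μ 1) = 1 := by
  simp [evalOneHom]

lemma evalOneHom_oneSubVar {r : ℕ} (i : Fin r) : evalOneHom r (oneSubVar i) = 0 := by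
  simp [oneSubVar, evalOneHom_single]

/-! ### Expansion at `t = 1` -/

/-- The unit `1 + X_i` of the ring of formal power series. -/
def oneAddX {r : ℕ} (i : Fin r) : (MvPowerSeries (Fin r) ℤ)ˣ :=
  ((MvPowerSeries.isUnit_iff_constantCoeff (φ := 1 + MvPowerSeries.X i)).mpr (by simp)).unit

/-- The Taylor expansion of Laurent polynomials at `t = 1`: the ring homomorphism to formal power
series with `t_i ↦ 1 + X_i`. -/
def taylorOne (r : ℕ) : MultiLaurent r →+* MvPowerSeries (Fin r) ℤ :=
  (AddMonoidAlgebra.lift ℤ (MvPowerSeries (Fin r) ℤ) (Fin r → ℤ)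
    { toFun := fun μ => ((∏ i, oneAddX i ^ (μ.toAdd i) : (MvPowerSeries (Fin r) ℤ)ˣ) :
        MvPowerSeries (Fin r) ℤ)
      map_one' := by simp
      map_mul' := fun μ μ' => by
        simp only [toAdd_mul, Pi.add_apply, zpow_add, Finset.prod_mul_distrib,
          Units.val_mul] }).toRingHom

lemma taylorOne_single {r : ℕ} (μ : Fin r → ℤ) :
    taylorOne r (AddMonoidAlgebra.single μ 1) =
      ((∏ i, oneAddX i ^ (μ i) : (MvPowerSeries (Fin r) ℤ)ˣ) : MvPowerSeries (Fin r) ℤ) :=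
  Eq.trans (AddMonoidAlgebra.lift_single _ μ 1) (one_smul ℤ _)

lemma taylorOne_oneSubVar {r : ℕ} (i : Fin r) :
    taylorOne r (oneSubVar i) = - MvPowerSeries.X i := by
  rw [oneSubVar, map_sub, map_one, taylorOne_single]
  rw [Finset.prod_eq_single i (fun j _ hj => by simp [hj]) (by simp)]
  simp [oneAddX]

lemma constantCoeff_taylorOne {r : ℕ} (Q : MultiLaurent r) :
    MvPowerSeries.constantCoeff (taylorOne r Q) = Q.evalOne := by
  rw [evalOne_eq]
  suffices h : (MvPowerSeries.constantCoeff (σ := Fin r) (R := ℤ)).comp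
      (taylorOne r) = (evalOneHom r : MultiLaurent r →+* ℤ) from congrArg (fun f => f Q) h
  refine AddMonoidAlgebra.ringHom_ext (fun a => ?_) (fun μ => ?_)
  · exact DFunLike.congr_fun (Subsingleton.elim
      (((MvPowerSeries.constantCoeff (σ := Fin r) (R := ℤ)).comp (taylorOne r)).comp
        AddMonoidAlgebra.singleZeroRingHom)
      ((evalOneHom r : MultiLaurent r →+* ℤ).comp AddMonoidAlgebra.singleZeroRingHom)) a
  have h : Units.map (MvPowerSeries.constantCoeff (σ := Fin r) (R := ℤ)).toMonoidHom
      (∏ i, oneAddX i ^ (μ i)) = 1 := by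
    rw [map_prod]
    refine Finset.prod_eq_one fun i _ => ?_
    rw [map_zpow]
    have : Units.map (MvPowerSeries.constantCoeff (σ := Fin r) (R := ℤ)).toMonoidHom (oneAddX i)
        = 1 := by
      ext
      simp [oneAddX]
    rw [this, one_zpow]
  refine Eq.trans ?_ (evalOneHom_single μ).symm
  rw [RingHom.comp_apply, taylorOne_single]
  exact congrArg Units.val h

/-- If `∑ Q_n / (1 - t) ^ n = 0`, the sum over all `n` with `|n| = d`, then all `Q_n(1)` vanish. -/
lemma evalOne_eq_zero_of_sum_fractionCoeff_eq_zero {r d : ℕ} {Q : (Fin r → ℕ) → MultiLaurent r}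
    (h : ∀ ν, ∑ n ∈ weightSet r (d : WithBot ℕ∞), fractionCoeff (Q n) n ν = 0)
    {n : Fin r → ℕ} (hn : n ∈ weightSet r (d : WithBot ℕ∞)) : (Q n).evalOne = 0 := by
  -- Multiplying by `∏ (1 - t_i) ^ d` turns the relation into one between Laurent polynomials.
  have hle : ∀ m ∈ weightSet r (d : WithBot ℕ∞), ∀ i, m i ≤ d := fun m hm i => by
    rw [← mem_weightSet_natCast.mp hm]
    exact Finset.single_le_sum (f := m) (fun _ _ => Nat.zero_le _) (Finset.mem_univ i)
  have hclear : ∀ m : Fin r → ℕ,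
      laurentAct r (∏ i, oneSubVar i ^ m i) (poleCoeff m) = poleCoeff 0 := by
    intro m
    induction hs : ∑ i, m i generalizing m with
    | zero =>
      have : m = 0 := funext fun i => by simpa using Finset.sum_eq_zero_iff.mp hs i
      subst this
      simp
    | succ s ih =>
      obtain ⟨i, -, hi⟩ : ∃ i ∈ Finset.univ, m i ≠ 0 := by
        by_contra! hc
        rw [Finset.sum_eq_zero hc] at hs
        omega
      obtain ⟨m', rfl⟩ : ∃ m', m = m' + Pi.single i 1 := ⟨m - Pi.single i 1, by
        funext j
        by_cases hj : j = i
        · subst hj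
          simp only [Pi.add_apply, Pi.sub_apply, Pi.single_eq_same]
          omega
        · simp [hj]⟩
      have hprod : ∏ j, (oneSubVar j : MultiLaurent r) ^ (m' + Pi.single i 1 : Fin r → ℕ) j =
          (∏ j, oneSubVar j ^ m' j) * oneSubVar i := by
        simp only [Pi.add_apply, pow_add, Finset.prod_mul_distrib]
        congr 1
        rw [Finset.prod_eq_single i (fun j _ hj => by simp [hj]) (by simp)]
        simp
      rw [hprod, map_mul, Module.End.mul_apply, laurentAct_oneSubVar_poleCoeff]
      refine ih m' ?_
      simp only [Pi.add_apply, Finset.sum_add_distrib] at hs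
      simpa using hs
  have hlaurent : ∑ m ∈ weightSet r (d : WithBot ℕ∞), Q m * ∏ i, oneSubVar i ^ (d - m i) = 0 := by
    rw [← AddMonoidAlgebra.coeff_eq_zero]
    ext1 ν
    rw [← laurentAct_poleCoeff_zero, map_sum, LinearMap.sum_apply]
    have h0 : ∑ m ∈ weightSet r (d : WithBot ℕ∞), fractionCoeff (Q m) m = 0 := by
      funext ν
      simpa using h ν
    have h1 := congrArg (laurentAct r (∏ i, oneSubVar i ^ d)) h0
    rw [map_sum, map_zero] at h1
    refine Eq.trans (congrFun (Finset.sum_congr rfl fun m hm => ?_) ν) (congrFun h1 ν)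
    rw [fractionCoeff_eq, ← Module.End.mul_apply, ← map_mul, ← hclear m, ← Module.End.mul_apply,
      ← map_mul]
    congr 2
    rw [mul_assoc, ← Finset.prod_mul_distrib, mul_comm]
    congr 1
    refine Finset.prod_congr rfl fun i _ => ?_
    rw [← pow_add, Nat.sub_add_cancel (hle m hm i)]
  -- The Taylor coefficient at `X ^ (d - n)` isolates the summand belonging to `n`.
  have ht := congrArg (taylorOne r) hlaurent
  have hexp : ∀ m : Fin r → ℕ, taylorOne r (Q m * ∏ i, oneSubVar i ^ (d - m i)) =
      taylorOne r (Q m) * MvPowerSeries.monomial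
        (Finsupp.equivFunOnFinite.symm fun i => d - m i) (∏ i : Fin r, (-1 : ℤ) ^ (d - m i)) := by
    intro m
    rw [map_mul, map_prod]
    congr 1
    simp only [map_pow, taylorOne_oneSubVar]
    have hX : ∀ i : Fin r, (-MvPowerSeries.X i : MvPowerSeries (Fin r) ℤ) ^ (d - m i) =
        MvPowerSeries.monomial (Finsupp.single i (d - m i)) ((-1) ^ (d - m i)) := fun i => by
      rw [MvPowerSeries.X_def, ← map_neg, MvPowerSeries.monomial_pow]
      simp
    rw [Finset.prod_congr rfl fun i _ => hX i, MvPowerSeries.prod_monomial]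
    congr 2
    ext i
    rw [Finsupp.finsetSum_apply, Finset.sum_eq_single i (fun j _ hj => by simp [hj]) (by simp)]
    simp
  rw [map_sum, map_zero] at ht
  have ht' := congrArg
    (MvPowerSeries.coeff (Finsupp.equivFunOnFinite.symm fun i => d - n i)) ht
  rw [map_sum, map_zero, Finset.sum_eq_single n] at ht'
  · rw [hexp, MvPowerSeries.coeff_mul_monomial, if_pos le_rfl, tsub_self,
      MvPowerSeries.coeff_zero_eq_constantCoeff_apply, constantCoeff_taylorOne] at ht'
    refine (mul_eq_zero.mp ht').resolve_right (Finset.prod_ne_zero_iff.mpr fun i _ => ?_)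
    exact pow_ne_zero _ (by norm_num)
  · intro m hm hmn
    rw [hexp, MvPowerSeries.coeff_mul_monomial, if_neg]
    intro hc
    refine hmn (funext fun i => ?_)
    have hge : ∀ j, n j ≤ m j := fun j => by
      have := hc j
      have h1 := hle m hm j
      have h2 := hle n hn j
      simp only [Finsupp.equivFunOnFinite_symm_apply_apply] at this
      omega
    have hsum : ∑ j, n j = ∑ j, m j := by
      rw [mem_weightSet_natCast.mp hm, mem_weightSet_natCast.mp hn]
    exact ((Finset.sum_eq_sum_iff_of_le fun j _ => hge j).mp hsum i (Finset.mem_univ i)).symm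
  · exact fun hc => (hc hn).elim

/-! ### Functions with a pole decomposition of a given weight -/

/-- `H` is the coefficient function of a sum `∑_{|n| = d} Q_n / (1 - t) ^ n`, with
`E n = Q_n(1)` if `|n| = d` and `E n = 0` for all other `n`. -/
def HasPoles {r : ℕ} (d : ℕ) (H : (Fin r → ℤ) → ℤ) (E : (Fin r → ℕ) → ℤ) : Prop :=
  (∃ Q : (Fin r → ℕ) → MultiLaurent r,
    (∀ ν, H ν = ∑ n ∈ weightSet r (d : WithBot ℕ∞), fractionCoeff (Q n) n ν) ∧
      ∀ n ∈ weightSet r (d : WithBot ℕ∞), (Q n).evalOne = E n) ∧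
  ∀ n, n ∉ weightSet r (d : WithBot ℕ∞) → E n = 0

lemma fractionCoeff_sum {r : ℕ} {τ : Type*} (T : Finset τ) (Q : τ → MultiLaurent r)
    (n : Fin r → ℕ) (ν : Fin r → ℤ) :
    fractionCoeff (∑ t ∈ T, Q t) n ν = ∑ t ∈ T, fractionCoeff (Q t) n ν := by
  simp only [fractionCoeff_eq, map_sum, LinearMap.sum_apply, Finset.sum_apply]

lemma evalOne_sum {r : ℕ} {τ : Type*} (T : Finset τ) (Q : τ → MultiLaurent r) :
    (∑ t ∈ T, Q t).evalOne = ∑ t ∈ T, (Q t).evalOne := by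
  simp only [evalOne_eq, map_sum]

namespace HasPoles

variable {r d : ℕ} {H G : (Fin r → ℤ) → ℤ} {E F : (Fin r → ℕ) → ℤ}

/-- Fractions with the same denominator can be collected. -/
lemma of_sum {τ : Type*} (T : Finset τ) (n : τ → Fin r → ℕ) (Q : τ → MultiLaurent r)
    (hn : ∀ t ∈ T, ∑ i, n t i = d) :
    HasPoles d (fun ν => ∑ t ∈ T, fractionCoeff (Q t) (n t) ν)
      (fun m => ∑ t ∈ T with n t = m, (Q t).evalOne) := by
  refine ⟨⟨fun m => ∑ t ∈ T with n t = m, Q t, fun ν => ?_, fun m _ => evalOne_sum _ _⟩,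
    fun m hm => Finset.sum_eq_zero fun t ht => ?_⟩
  · beta_reduce
    rw [← Finset.sum_fiberwise_of_maps_to (g := n) (t := weightSet r (d : WithBot ℕ∞))
      fun t ht => mem_weightSet_natCast.mpr (hn t ht)]
    refine Finset.sum_congr rfl fun m _ => ?_
    rw [fractionCoeff_sum]
    refine Finset.sum_congr rfl fun t ht => ?_
    rw [(Finset.mem_filter.mp ht).2]
  · rw [Finset.mem_filter] at ht
    exact (hm (ht.2 ▸ mem_weightSet_natCast.mpr (hn t ht.1))).elim

lemma eq_zero_of_ne (h : HasPoles d H E) {n : Fin r → ℕ} (hn : ∑ i, n i ≠ d) : E n = 0 :=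
  h.2 n fun hc => hn (mem_weightSet_natCast.mp hc)

protected lemma zero : HasPoles d (0 : (Fin r → ℤ) → ℤ) 0 :=
  ⟨⟨0, by simp [fractionCoeff], by simp [evalOne_eq]⟩, fun _ _ => rfl⟩

protected lemma add (h : HasPoles d H E) (h' : HasPoles d G F) : HasPoles d (H + G) (E + F) := by
  obtain ⟨⟨Q, hQ, hE⟩, h0⟩ := h
  obtain ⟨⟨Q', hQ', hF⟩, h0'⟩ := h'
  refine ⟨⟨Q + Q', fun ν => ?_, fun n hn => ?_⟩, fun n hn => ?_⟩
  · simp only [Pi.add_apply, hQ, hQ', fractionCoeff_eq, map_add, LinearMap.add_apply,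
      Finset.sum_add_distrib]
  · rw [Pi.add_apply, Pi.add_apply, ← hE n hn, ← hF n hn]
    simp only [evalOne_eq, map_add]
  · rw [Pi.add_apply, h0 n hn, h0' n hn, add_zero]

protected lemma neg (h : HasPoles d H E) : HasPoles d (-H) (-E) := by
  obtain ⟨⟨Q, hQ, hE⟩, h0⟩ := h
  refine ⟨⟨-Q, fun ν => ?_, fun n hn => ?_⟩, fun n hn => ?_⟩
  · simp only [Pi.neg_apply, hQ, fractionCoeff_eq, map_neg, LinearMap.neg_apply,
      Finset.sum_neg_distrib]
  · rw [Pi.neg_apply, Pi.neg_apply, ← hE n hn]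
    simp only [evalOne_eq, map_neg]
  · rw [Pi.neg_apply, h0 n hn, neg_zero]

lemma unique (h : HasPoles d H E) (h' : HasPoles d H F) : E = F := by
  obtain ⟨⟨Q, hQ, hE⟩, h0⟩ := h.add h'.neg
  funext n
  by_cases hn : n ∈ weightSet r (d : WithBot ℕ∞)
  · have h1 := evalOne_eq_zero_of_sum_fractionCoeff_eq_zero (Q := Q)
      (fun ν => by rw [← hQ ν]; simp) hn
    rw [hE n hn] at h1
    exact sub_eq_zero.mp (by simpa [sub_eq_add_neg] using h1)
  · rw [h.2 n hn, h'.2 n hn]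

lemma translate (h : HasPoles d H E) (ν₀ : Fin r → ℤ) : HasPoles d (fun ν => H (ν - ν₀)) E := by
  obtain ⟨⟨Q, hQ, hE⟩, h0⟩ := h
  refine ⟨⟨fun n => AddMonoidAlgebra.single ν₀ 1 * Q n, fun ν => ?_, fun n hn => ?_⟩, h0⟩
  · beta_reduce
    rw [hQ]
    refine Finset.sum_congr rfl fun n _ => ?_
    rw [fractionCoeff_eq, fractionCoeff_eq, map_mul, Module.End.mul_apply, laurentAct_single]
  · rw [← hE n hn, evalOne_eq, evalOne_eq, map_mul, evalOneHom_single, one_mul]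

/-- The weight may be increased by multiplying all `Q_n` by some `1 - t_i`; this makes all values
`Q_n(1)` vanish. -/
lemma raise (h : HasPoles d H E) (i : Fin r) : HasPoles (d + 1) H 0 := by
  obtain ⟨⟨Q, hQ, hE⟩, h0⟩ := h
  convert of_sum (d := d + 1) (weightSet r (d : WithBot ℕ∞)) (fun n => n + Pi.single i 1)
    (fun n => Q n * oneSubVar i) (fun n hn => ?_) using 1
  · funext ν
    rw [hQ]
    refine Finset.sum_congr rfl fun n _ => ?_
    rw [fractionCoeff_eq, fractionCoeff_eq, map_mul, Module.End.mul_apply,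
      laurentAct_oneSubVar_poleCoeff]
  · funext m
    exact (Finset.sum_eq_zero fun n _ => by
      rw [evalOne_eq, map_mul, evalOneHom_oneSubVar, mul_zero]).symm
  · simp [Finset.sum_add_distrib, mem_weightSet_natCast.mp hn]

lemma raise_of_lt {d' : ℕ} (h : HasPoles d H E) (i : Fin r) (hd : d < d') : HasPoles d' H 0 := by
  obtain ⟨k, rfl⟩ := Nat.exists_eq_add_of_lt hd
  induction k with
  | zero => exact h.raise i
  | succ k ih => exact (ih (by omega)).raise i

/-- The coefficient functions occurring in pole decompositions have support bounded below. -/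
lemma exists_lower_bound (h : HasPoles d H E) :
    ∃ c : ℤ, ∀ ν, (∃ i, ν i < c) → H ν = 0 := by
  obtain ⟨⟨Q, hQ, hE⟩, h0⟩ := h
  obtain ⟨c, hc⟩ : ∃ c : ℤ, ∀ n ∈ weightSet r (d : WithBot ℕ∞), ∀ μ ∈ (Q n).coeff.support,
      ∀ i, c ≤ μ i := by
    obtain ⟨c, hc⟩ := ((weightSet r (d : WithBot ℕ∞)).biUnion fun n =>
      (Q n).coeff.support.biUnion fun μ => Finset.univ.image μ).bddBelow
    refine ⟨c, fun n hn μ hμ i => hc ?_⟩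
    simp only [Finset.coe_biUnion, Finset.mem_coe, Finset.coe_image, Set.mem_iUnion]
    exact ⟨n, hn, μ, hμ, i, by simp, rfl⟩
  refine ⟨c, fun ν ⟨i, hi⟩ => ?_⟩
  rw [hQ]
  refine Finset.sum_eq_zero fun n hn => Finset.sum_eq_zero fun μ hμ => ?_
  exact mul_eq_zero_of_right _
    (poleCoeff_eq_zero (n := n) (ν := ν - μ) (i := i) (by have := hc n hn μ hμ i; simp; omega))

/-- If `(1 - t_i) H = G`, then a pole decomposition of `G` gives one of `H` in which all
denominators are divisible by `1 - t_i`. -/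
lemma of_sub_translate (h : HasPoles d G E) (i : Fin r)
    (hH : ∀ ν, H ν - H (ν - Pi.single i 1) = G ν) (hb : ∀ ν, ν i < 0 → H ν = 0) :
    HasPoles (d + 1) H (fun m => if m i = 0 then 0 else E (m - Pi.single i 1)) := by
  obtain ⟨⟨Q, hQ, hE⟩, h0⟩ := h
  have hmain := of_sum (d := d + 1) (weightSet r (d : WithBot ℕ∞)) (fun n => n + Pi.single i 1) Q
    (fun n hn => by simp [Finset.sum_add_distrib, mem_weightSet_natCast.mp hn])
  convert hmain using 1
  · -- Two bounded below solutions of `(1 - t_i) H = G` agree.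
    set H' : (Fin r → ℤ) → ℤ := fun ν => ∑ n ∈ weightSet r (d : WithBot ℕ∞),
      fractionCoeff (Q n) (n + Pi.single i 1) ν with hH'
    have hdiff : ∀ ν, H' ν - H' (ν - Pi.single i 1) = G ν := fun ν => by
      rw [hQ, hH', ← Finset.sum_sub_distrib]
      refine Finset.sum_congr rfl fun n _ => ?_
      rw [fractionCoeff_eq, fractionCoeff_eq, ← laurentAct_oneSubVar, ← Module.End.mul_apply,
        ← map_mul, mul_comm, map_mul, Module.End.mul_apply, laurentAct_oneSubVar_poleCoeff]
    obtain ⟨c, hc⟩ := hmain.exists_lower_bound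
    have hstep : ∀ (k : ℕ) (ν : Fin r → ℤ), ν i < min c 0 + k → H ν = H' ν := by
      intro k
      induction k with
      | zero =>
        intro ν hν
        rw [hb ν (by simp at hν; exact hν.2)]
        exact (hc ν ⟨i, by simp at hν; exact hν.1⟩).symm
      | succ k ih =>
        intro ν hν
        have h1 := ih (ν - Pi.single i 1) (by push_cast at hν; simp at hν ⊢; omega)
        linarith [hH ν, hdiff ν]
    funext ν
    exact hstep (ν i - min c 0 + 1).toNat ν (by omega)
  · funext m
    split_ifs with hm
    · refine (Finset.sum_eq_zero fun n hn => ?_).symm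
      have := congrFun (Finset.mem_filter.mp hn).2 i
      simp [hm] at this
    · have hm' : m - Pi.single i 1 + Pi.single i 1 = m := by
        funext j
        by_cases hj : j = i
        · subst hj
          simp only [Pi.add_apply, Pi.sub_apply, Pi.single_eq_same]
          omega
        · simp [hj]
      by_cases hmem : m - Pi.single i 1 ∈ weightSet r (d : WithBot ℕ∞)
      · rw [Finset.sum_eq_single (m - Pi.single i 1), hE _ hmem]
        · intro n hn hne
          refine (hne ?_).elim
          rw [← (Finset.mem_filter.mp hn).2, add_tsub_cancel_right]
        · intro hn
          exact (hn (Finset.mem_filter.mpr ⟨hmem, hm'⟩)).elim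
      · rw [h0 _ hmem]
        refine (Finset.sum_eq_zero fun n hn => (hmem ?_).elim).symm
        rw [Finset.mem_filter] at hn
        rw [← hn.2, add_tsub_cancel_right]
        exact hn.1

end HasPoles

/-! ### Growth of functions with a pole decomposition -/

lemma invOneSubCoeff_nonneg (n : ℕ) (k : ℤ) : 0 ≤ invOneSubCoeff n k := by
  rcases lt_or_ge k 0 with hk | hk
  · rw [invOneSubCoeff_of_neg hk]
  · lift k to ℕ using hk
    cases n with
    | zero =>
      rw [invOneSubCoeff_zero]
      split_ifs <;> simp
    | succ n =>
      rw [invOneSubCoeff_natCast, PowerSeries.invOneSubPow_val_succ_eq_mk_add_choose]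
      simp

lemma sum_range_invOneSubCoeff (n k : ℕ) :
    ∑ j ∈ Finset.range (k + 1), invOneSubCoeff n (j : ℤ) = invOneSubCoeff (n + 1) (k : ℤ) := by
  induction k with
  | zero =>
    have := invOneSubCoeff_succ_sub n 0
    rw [invOneSubCoeff_of_neg (k := 0 - 1) (by omega), sub_zero] at this
    simpa using this.symm
  | succ k ih =>
    have := invOneSubCoeff_succ_sub n ((k + 1 : ℕ) : ℤ)
    rw [Finset.sum_range_succ, ih, ← this]
    push_cast
    rw [add_sub_cancel_right]
    ring

lemma sum_range_invOneSubCoeff_le (n k : ℕ) :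
    ∑ j ∈ Finset.range (k + 1), invOneSubCoeff n (j : ℤ) ≤ ((k : ℤ) + 1) ^ n := by
  induction n generalizing k with
  | zero =>
    simp [invOneSubCoeff_zero]
  | succ n ih =>
    calc ∑ j ∈ Finset.range (k + 1), invOneSubCoeff (n + 1) (j : ℤ)
        ≤ ∑ j ∈ Finset.range (k + 1), ((k : ℤ) + 1) ^ n := by
          refine Finset.sum_le_sum fun j hj => ?_
          rw [← sum_range_invOneSubCoeff]
          refine (ih j).trans ?_
          have : j ≤ k := by simpa [Nat.lt_succ_iff] using hj
          gcongr
      _ = ((k : ℤ) + 1) ^ (n + 1) := by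
          rw [Finset.sum_const, Finset.card_range]
          simp [pow_succ, mul_comm]

lemma sum_Icc_invOneSubCoeff_le (n k : ℕ) (m : ℤ) :
    ∑ a ∈ Finset.Icc (0 : ℤ) k, invOneSubCoeff n (a - m) ≤
      (((m.natAbs : ℤ) + 1) * (k + 1)) ^ n := by
  calc ∑ a ∈ Finset.Icc (0 : ℤ) k, invOneSubCoeff n (a - m)
      = ∑ a ∈ Finset.Icc (0 : ℤ) k with m ≤ a, invOneSubCoeff n (((a - m).toNat : ℕ) : ℤ) := by
        rw [Finset.sum_filter]
        refine Finset.sum_congr rfl fun a _ => ?_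
        split_ifs with h
        · rw [Int.toNat_of_nonneg (by omega)]
        · exact invOneSubCoeff_of_neg (by omega)
    _ = ∑ j ∈ (Finset.filter (fun a => m ≤ a) (Finset.Icc (0 : ℤ) k)).image
          (fun a => (a - m).toNat), invOneSubCoeff n (j : ℤ) := by
        rw [Finset.sum_image]
        intro a ha b hb hab
        simp only [Finset.coe_filter, Set.mem_ofPred_eq] at ha hb
        dsimp only at hab
        omega
    _ ≤ ∑ j ∈ Finset.range (k + m.natAbs + 1), invOneSubCoeff n (j : ℤ) := by
        refine Finset.sum_le_sum_of_subset_of_nonneg (fun j hj => ?_)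
          fun j _ _ => invOneSubCoeff_nonneg _ _
        simp only [Finset.mem_image, Finset.mem_filter, Finset.mem_Icc] at hj
        obtain ⟨a, ha, rfl⟩ := hj
        rw [Finset.mem_range]
        omega
    _ ≤ (((k + m.natAbs : ℕ) : ℤ) + 1) ^ n := sum_range_invOneSubCoeff_le _ _
    _ ≤ (((m.natAbs : ℤ) + 1) * (k + 1)) ^ n := by
        push_cast
        gcongr
        have : (0 : ℤ) ≤ |m| * k := by positivity
        nlinarith

/-- The box `[0, k] ^ r` of multidegrees. -/
def degreeBox (r k : ℕ) : Finset (Fin r → ℤ) :=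
  Fintype.piFinset fun _ => Finset.Icc (0 : ℤ) k

/-- The sums of `H` over boxes of side length `k` grow at most like `k ^ d`, if `H` has a pole
decomposition of weight `d`. -/
lemma HasPoles.exists_sum_degreeBox_le {r d : ℕ} {H : (Fin r → ℤ) → ℤ} {E : (Fin r → ℕ) → ℤ}
    (h : HasPoles d H E) :
    ∃ C : ℕ, ∀ k : ℕ, ∑ ν ∈ degreeBox r k, H ν ≤ C * ((k : ℤ) + 1) ^ d := by
  obtain ⟨⟨Q, hQ, hE⟩, h0⟩ := h
  refine ⟨∑ n ∈ weightSet r (d : WithBot ℕ∞), ∑ μ ∈ (Q n).coeff.support,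
    ((Q n).coeff μ).natAbs * ∏ i, ((μ i).natAbs + 1) ^ n i, fun k => ?_⟩
  simp only [hQ]
  rw [Finset.sum_comm]
  push_cast
  rw [Finset.sum_mul]
  refine Finset.sum_le_sum fun n hn => ?_
  simp only [fractionCoeff, Finsupp.sum]
  rw [Finset.sum_comm, Finset.sum_mul]
  refine Finset.sum_le_sum fun μ _ => ?_
  rw [← Finset.mul_sum, degreeBox,
    ← Finset.prod_univ_sum (fun _ => Finset.Icc (0 : ℤ) k)
      (fun i a => invOneSubCoeff (n i) (a - μ i)), mul_assoc]
  have hnonneg : 0 ≤ ∏ i, ∑ a ∈ Finset.Icc (0 : ℤ) k, invOneSubCoeff (n i) (a - μ i) :=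
    Finset.prod_nonneg fun i _ => Finset.sum_nonneg fun a _ => invOneSubCoeff_nonneg _ _
  refine (mul_le_mul_of_nonneg_right (le_abs_self _) hnonneg).trans ?_
  refine mul_le_mul_of_nonneg_left ?_ (abs_nonneg _)
  calc ∏ i, ∑ a ∈ Finset.Icc (0 : ℤ) k, invOneSubCoeff (n i) (a - μ i)
      ≤ ∏ i, ((((μ i).natAbs : ℤ) + 1) * (k + 1)) ^ n i :=
        Finset.prod_le_prod
          (fun i _ => Finset.sum_nonneg fun a _ => invOneSubCoeff_nonneg _ _)
          fun i _ => sum_Icc_invOneSubCoeff_le _ _ _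
    _ = (∏ i, (|μ i| + 1) ^ n i) * ((k : ℤ) + 1) ^ d := by
        simp only [mul_pow, Finset.prod_mul_distrib, Int.natCast_natAbs]
        rw [Finset.prod_pow_eq_pow_sum, mem_weightSet_natCast.mp hn]

/-! ### Summation over all multidegrees of a given total degree -/

lemma invOneSubPow_sum {ι : Type*} (s : Finset ι) (n : ι → ℕ) :
    (PowerSeries.invOneSubPow ℤ (∑ i ∈ s, n i)).val =
      ∏ i ∈ s, (PowerSeries.invOneSubPow ℤ (n i)).val := by
  classical
  induction s using Finset.induction_on with
  | empty => simp [PowerSeries.invOneSubPow_zero]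
  | insert i s hi ih =>
    rw [Finset.sum_insert hi, Finset.prod_insert hi, PowerSeries.invOneSubPow_add, Units.val_mul,
      ih]

/-- The identity `∏ 1 / (1 - t) ^ n_i = 1 / (1 - t) ^ |n|` of power series, coefficientwise. -/
lemma sum_poleCoeff {r : ℕ} (n : Fin r → ℕ) (μ : Fin r → ℤ) (k : ℤ) (s : Finset (Fin r → ℤ))
    (hs : ∀ ν ∈ s, ∑ i, ν i = k) (hs' : ∀ ν, ∑ i, ν i = k → μ ≤ ν → ν ∈ s) :
    ∑ ν ∈ s, poleCoeff n (ν - μ) = invOneSubCoeff (∑ i, n i) (k - ∑ i, μ i) := by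
  rcases lt_or_ge (k - ∑ i, μ i) 0 with hk | hk
  · rw [invOneSubCoeff_of_neg hk]
    refine Finset.sum_eq_zero fun ν hν => ?_
    obtain ⟨i, -, hi⟩ : ∃ i ∈ Finset.univ, ν i < μ i := by
      refine Finset.exists_lt_of_sum_lt ?_
      rw [hs ν hν]
      omega
    exact poleCoeff_eq_zero (i := i) (by simpa using hi)
  · obtain ⟨K, hK⟩ := Int.eq_ofNat_of_zero_le hk
    rw [hK, invOneSubCoeff_natCast, invOneSubPow_sum, PowerSeries.coeff_prod]
    symm
    refine Finset.sum_of_injOn (fun l i => μ i + (l i : ℤ)) ?_ ?_ ?_ ?_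
    · intro l _ l' _ hll
      ext i
      have := congrFun hll i
      simpa using this
    · intro l hl
      rw [Finset.mem_coe, Finset.mem_finsuppAntidiag] at hl
      refine hs' _ ?_ fun i => by simp
      rw [Finset.sum_add_distrib, ← Nat.cast_sum, hl.1]
      omega
    · intro ν hν hν'
      by_contra hne
      have hle : ∀ i, μ i ≤ ν i := by
        by_contra! hc
        obtain ⟨i, hi⟩ := hc
        exact hne (poleCoeff_eq_zero (i := i) (by simpa using hi))
      refine hν' ⟨Finsupp.equivFunOnFinite.symm fun i => (ν i - μ i).toNat, ?_, ?_⟩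
      · rw [Finset.mem_coe, Finset.mem_finsuppAntidiag]
        refine ⟨?_, by simp⟩
        have h1 := hs ν hν
        zify
        simp only [Finsupp.equivFunOnFinite_symm_apply_apply]
        rw [Finset.sum_congr rfl fun i _ => Int.toNat_of_nonneg (sub_nonneg.mpr (hle i)),
          Finset.sum_sub_distrib, h1]
        omega
      · funext i
        have := hle i
        simp only [Finsupp.equivFunOnFinite_symm_apply_apply]
        omega
    · intro l _
      simp only [poleCoeff, Pi.sub_apply, add_sub_cancel_left, invOneSubCoeff_natCast]

/-- A finite set of multidegrees of total degree `k` containing all those with entries `≥ c`. -/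
def totalDegreeSet (r : ℕ) (c k : ℤ) : Finset (Fin r → ℤ) :=
  {ν ∈ Fintype.piFinset fun _ => Finset.Icc c (k - r * c + c) | ∑ i, ν i = k}

lemma mem_totalDegreeSet {r : ℕ} {c k : ℤ} {ν : Fin r → ℤ} :
    ν ∈ totalDegreeSet r c k ↔ ∑ i, ν i = k ∧ ∀ i, c ≤ ν i := by
  simp only [totalDegreeSet, Finset.mem_filter, Fintype.mem_piFinset, Finset.mem_Icc]
  refine ⟨fun h => ⟨h.2, fun i => (h.1 i).1⟩, fun h => ⟨fun i => ⟨h.2 i, ?_⟩, h.1⟩⟩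
  have h1 := Finset.single_le_sum (f := fun j => ν j - c) (fun j _ => sub_nonneg.mpr (h.2 j))
    (Finset.mem_univ i)
  rw [Finset.sum_sub_distrib, h.1] at h1
  simp at h1
  linarith

/-- The sums of `H` over the multidegrees of total degree `k` are eventually given by a polynomial
of degree `< d` whose coefficient of degree `d - 1` is `∑ E n / (d - 1)!`, if `H` has a pole
decomposition of weight `d > 0`. -/
lemma HasPoles.exists_totalDegree_polynomial {r d : ℕ} {H : (Fin r → ℤ) → ℤ}
    {E : (Fin r → ℕ) → ℤ} (h : HasPoles (d + 1) H E) :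
    ∃ P : Polynomial ℚ, (d.factorial : ℚ) * P.coeff d =
        ∑ n ∈ weightSet r ((d + 1 : ℕ) : WithBot ℕ∞), (E n : ℚ) ∧
      ∃ c₀ : ℤ, ∀ c ≤ c₀, ∀ᶠ k : ℤ in Filter.atTop,
        ((∑ ν ∈ totalDegreeSet r c k, H ν : ℤ) : ℚ) = P.eval (k : ℚ) := by
  obtain ⟨⟨Q, hQ, hE⟩, h0⟩ := h
  have hW : ∀ n ∈ weightSet r ((d + 1 : ℕ) : WithBot ℕ∞), ∑ i, n i = d + 1 :=
    fun n hn => mem_weightSet_natCast.mp hn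
  clear h0
  generalize weightSet r ((d + 1 : ℕ) : WithBot ℕ∞) = W at hQ hE hW ⊢
  obtain ⟨c, hc⟩ := ((W).biUnion fun n =>
    (Q n).coeff.support.biUnion fun μ => Finset.univ.image μ).bddBelow
  replace hc : ∀ n ∈ W, ∀ μ ∈ (Q n).coeff.support,
      ∀ i, c ≤ μ i := fun n hn μ hμ i => hc (by
    simp only [Finset.coe_biUnion, Finset.mem_coe, Finset.coe_image, Set.mem_iUnion]
    exact ⟨n, hn, μ, hμ, i, by simp, rfl⟩)
  obtain ⟨K, hK⟩ := ((W).biUnion fun n =>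
    (Q n).coeff.support.image fun μ => ∑ i, μ i).bddAbove
  replace hK : ∀ n ∈ W, ∀ μ ∈ (Q n).coeff.support,
      ∑ i, μ i ≤ K := fun n hn μ hμ => hK (by
    simp only [Finset.coe_biUnion, Finset.mem_coe, Finset.coe_image, Set.mem_iUnion]
    exact ⟨n, hn, μ, hμ, rfl⟩)
  refine ⟨∑ n ∈ W, ∑ μ ∈ (Q n).coeff.support,
    Polynomial.C ((Q n).coeff μ : ℚ) *
      (Polynomial.preHilbertPoly ℚ d 0).comp (Polynomial.X - Polynomial.C ((∑ i, μ i : ℤ) : ℚ)),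
    ?_, c, fun c' hc' => ?_⟩
  · simp only [Polynomial.finsetSum_coeff, Polynomial.coeff_C_mul]
    rw [Finset.mul_sum]
    refine Finset.sum_congr rfl fun n hn => ?_
    rw [← hE n hn, MultiLaurent.evalOne, Finsupp.sum, Finset.mul_sum, Int.cast_sum]
    refine Finset.sum_congr rfl fun μ _ => ?_
    have hcoeff : ((Polynomial.preHilbertPoly ℚ d 0).comp
        (Polynomial.X - Polynomial.C ((∑ i, μ i : ℤ) : ℚ))).coeff d = (d.factorial : ℚ)⁻¹ := by
      have h1 := Polynomial.coeff_comp_degree_mul_degree (p := Polynomial.preHilbertPoly ℚ d 0)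
        (q := Polynomial.X - Polynomial.C ((∑ i, μ i : ℤ) : ℚ))
        (by rw [Polynomial.natDegree_X_sub_C]; exact one_ne_zero)
      rw [Polynomial.natDegree_X_sub_C, Polynomial.natDegree_preHilbertPoly, mul_one,
        Polynomial.leadingCoeff_X_sub_C, one_pow, mul_one,
        Polynomial.leadingCoeff_preHilbertPoly] at h1
      exact h1
    rw [hcoeff]
    field_simp
  · filter_upwards [Filter.eventually_ge_atTop K] with k hk
    simp only [hQ]
    rw [Finset.sum_comm, Polynomial.eval_finsetSum]
    push_cast
    refine Finset.sum_congr rfl fun n hn => ?_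
    rw [Polynomial.eval_finsetSum]
    simp only [fractionCoeff, Finsupp.sum]
    push_cast
    rw [Finset.sum_comm]
    refine Finset.sum_congr rfl fun μ hμ => ?_
    rw [← Finset.mul_sum, Polynomial.eval_mul, Polynomial.eval_C, Polynomial.eval_comp]
    congr 1
    have h1 := sum_poleCoeff n μ k (totalDegreeSet r c' k)
      (fun ν hν => (mem_totalDegreeSet.mp hν).1)
      (fun ν hν hμν => mem_totalDegreeSet.mpr
        ⟨hν, fun i => hc'.trans ((hc n hn μ hμ i).trans (hμν i))⟩)
    have h2 : (0 : ℤ) ≤ k - ∑ i, μ i := by linarith [hK n hn μ hμ]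
    obtain ⟨m, hm⟩ := Int.eq_ofNat_of_zero_le h2
    have h3 : Polynomial.eval (k : ℚ) (Polynomial.X - Polynomial.C ((∑ i, μ i : ℤ) : ℚ)) =
        (m : ℚ) := by
      rw [Polynomial.eval_sub, Polynomial.eval_X, Polynomial.eval_C]
      exact_mod_cast hm
    push_cast at h3
    rw [h3, Polynomial.preHilbertPoly_eq_choose_sub_add ℚ d (Nat.zero_le m)]
    rw [hm, hW n hn, invOneSubCoeff_natCast,
      PowerSeries.invOneSubPow_val_succ_eq_mk_add_choose, PowerSeries.coeff_mk] at h1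
    simp only [poleCoeff, Pi.sub_apply] at h1
    rw [tsub_zero, add_comm m d]
    exact_mod_cast h1

/-- In weight zero, `H` has finite support, and its sum of values is `∑ E n`. -/
lemma HasPoles.exists_sum_eq_of_zero {r : ℕ} {H : (Fin r → ℤ) → ℤ} {E : (Fin r → ℕ) → ℤ}
    (h : HasPoles 0 H E) :
    ∃ s : Finset (Fin r → ℤ), (∀ ν ∉ s, H ν = 0) ∧
      ∑ ν ∈ s, H ν = ∑ n ∈ weightSet r ((0 : ℕ) : WithBot ℕ∞), E n := by
  obtain ⟨⟨Q, hQ, hE⟩, h0⟩ := h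
  have hw : weightSet r ((0 : ℕ) : WithBot ℕ∞) = {0} := by
    ext n
    rw [mem_weightSet_natCast, Finset.mem_singleton]
    simp [funext_iff]
  have hH : H = (Q 0).coeff := by
    funext ν
    rw [hQ, hw, Finset.sum_singleton, fractionCoeff_eq, laurentAct_poleCoeff_zero]
  refine ⟨(Q 0).coeff.support, fun ν hν => by rw [hH]; exact Finsupp.notMem_support_iff.mp hν, ?_⟩
  rw [Finset.sum_congr rfl fun n hn => (hE n hn).symm, hw, Finset.sum_singleton, hH]
  rfl

/-! ### Homogeneous submodules -/

section Components

variable {A M ι : Type*} [CommRing A] [AddCommGroup M] [Module A M] [DecidableEq ι]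
  {ℳ : ι → Submodule A M}

/-- The projection of `M = ⨁ ℳ ν` to its summand of degree `ν`, as an endomorphism of `M`. -/
def gradedComponent (h : DirectSum.IsInternal ℳ) (ν : ι) : M →ₗ[A] M :=
  letI := h.chooseDecomposition
  (ℳ ν).subtype ∘ₗ DirectSum.component A ι (fun ν => ℳ ν) ν ∘ₗ
    (DirectSum.decomposeLinearEquiv ℳ).toLinearMap

lemma gradedComponent_mem (h : DirectSum.IsInternal ℳ) (ν : ι) (m : M) :
    gradedComponent h ν m ∈ ℳ ν :=
  Subtype.property _

lemma gradedComponent_of_mem (h : DirectSum.IsInternal ℳ) {ν : ι} {m : M} (hm : m ∈ ℳ ν) :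
    gradedComponent h ν m = m := by
  let := h.chooseDecomposition
  exact DirectSum.decompose_of_mem_same ℳ hm

lemma gradedComponent_of_mem_ne (h : DirectSum.IsInternal ℳ) {ν ν' : ι} {m : M} (hm : m ∈ ℳ ν)
    (hne : ν ≠ ν') : gradedComponent h ν' m = 0 := by
  let := h.chooseDecomposition
  exact DirectSum.decompose_of_mem_ne ℳ hm hne

lemma exists_sum_gradedComponent (h : DirectSum.IsInternal ℳ) (m : M) :
    ∃ s : Finset ι, ∑ ν ∈ s, gradedComponent h ν m = m := by
  classical
  let := h.chooseDecomposition
  exact ⟨_, DirectSum.sum_support_decompose ℳ m⟩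

end Components

variable {A B M : Type*} [CommRing A] [CommRing B] [Algebra A B] {r : ℕ}
  {𝓑 : (Fin r → ℕ) → Submodule A B} [AddCommGroup M] [Module A M] [Module B M]
  {ℳ : (Fin r → ℤ) → Submodule A M}

/-- The extension of an `ℕ^r`-grading to a `ℤ^r`-grading, by zero. -/
def extendGrading (𝓑 : (Fin r → ℕ) → Submodule A B) (ν : Fin r → ℤ) : Submodule A B :=
  ⨆ (μ : Fin r → ℕ) (_ : (fun i => (μ i : ℤ)) = ν), 𝓑 μ

lemma natCast_comp_injective :
    Function.Injective fun (μ : Fin r → ℕ) (i : Fin r) => (μ i : ℤ) := fun μ μ' h => by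
  funext i
  have := congrFun h i
  dsimp only at this
  exact_mod_cast this

lemma extendGrading_natCast (𝓑 : (Fin r → ℕ) → Submodule A B) (μ : Fin r → ℕ) :
    extendGrading 𝓑 (fun i => (μ i : ℤ)) = 𝓑 μ := by
  refine le_antisymm (iSup₂_le fun μ' h => ?_) (le_iSup₂_of_le μ rfl le_rfl)
  rw [natCast_comp_injective h]

lemma extendGrading_eq_bot_of_neg (𝓑 : (Fin r → ℕ) → Submodule A B) {ν : Fin r → ℤ} {i : Fin r}
    (h : ν i < 0) : extendGrading 𝓑 ν = ⊥ := by
  refine le_bot_iff.mp (iSup₂_le fun μ hμ => ?_)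
  have := congrFun hμ i
  omega

lemma exists_natCast_of_extendGrading_ne_bot {ν : Fin r → ℤ} (h : extendGrading 𝓑 ν ≠ ⊥) :
    ∃ μ : Fin r → ℕ, (fun i => (μ i : ℤ)) = ν := by
  by_contra! hc
  exact h (le_bot_iff.mp (iSup₂_le fun μ hμ => (hc μ hμ).elim))

lemma isMultigradedModule_extendGrading [GradedAlgebra 𝓑] :
    IsMultigradedModule 𝓑 (extendGrading 𝓑) where
  isInternal := by
    have hint := DirectSum.Decomposition.isInternal 𝓑
    refine DirectSum.isInternal_submodule_of_iSupIndep_of_iSup_eq_top ?_ ?_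
    · rw [← iSupIndep_ne_bot]
      choose f hf using fun ν : {ν // extendGrading 𝓑 ν ≠ ⊥} =>
        exists_natCast_of_extendGrading_ne_bot ν.2
      have hinj : Function.Injective f := fun ν ν' h => Subtype.ext (by rw [← hf, ← hf, h])
      convert hint.submodule_iSupIndep.comp hinj using 1
      funext ν
      rw [Function.comp_apply, ← extendGrading_natCast 𝓑 (f ν), hf]
    · rw [eq_top_iff, ← hint.submodule_iSup_eq_top]
      exact iSup_le fun μ => (extendGrading_natCast 𝓑 μ).ge.trans (le_iSup (extendGrading 𝓑) _)
  smul_mem μ ν b m hb hm := by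
    by_cases hν : extendGrading 𝓑 ν = ⊥
    · rw [hν, Submodule.mem_bot] at hm
      rw [hm, smul_zero]
      exact Submodule.zero_mem _
    · obtain ⟨μ', rfl⟩ := exists_natCast_of_extendGrading_ne_bot hν
      rw [extendGrading_natCast] at hm
      have h1 := extendGrading_natCast 𝓑 (μ + μ')
      simp only [Pi.add_apply, Nat.cast_add] at h1
      rw [h1]
      exact SetLike.mul_mem_graded hb hm

lemma extendGrading_isInternal (𝓑 : (Fin r → ℕ) → Submodule A B) [GradedAlgebra 𝓑] :
    DirectSum.IsInternal (extendGrading 𝓑) :=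
  isMultigradedModule_extendGrading.isInternal

/-- A `B`-submodule of `M = ⨁ ℳ ν` is homogeneous if it contains the homogeneous components of
its elements. -/
def IsHomogeneousSubmodule (h : DirectSum.IsInternal ℳ) (N : Submodule B M) : Prop :=
  ∀ (ν : Fin r → ℤ), ∀ m ∈ N, gradedComponent h ν m ∈ N

lemma gradedComponent_extendGrading [GradedAlgebra 𝓑]
    (h : DirectSum.IsInternal (extendGrading 𝓑)) (μ : Fin r → ℕ) (b : B) :
    gradedComponent h (fun i => (μ i : ℤ)) b = (DirectSum.decompose 𝓑 b μ : B) := by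
  classical
  conv_lhs => rw [← DirectSum.sum_support_decompose 𝓑 b, map_sum]
  have hmem : ∀ μ', (DirectSum.decompose 𝓑 b μ' : B) ∈ extendGrading 𝓑 (fun i => (μ' i : ℤ)) :=
    fun μ' => by
      rw [extendGrading_natCast]
      exact SetLike.coe_mem _
  rw [Finset.sum_eq_single μ]
  · exact gradedComponent_of_mem h (hmem μ)
  · exact fun μ' _ hne => gradedComponent_of_mem_ne h (hmem μ')
      fun hc => hne (natCast_comp_injective hc)
  · intro hμ
    rw [DFinsupp.notMem_support_iff.mp hμ]
    simp

lemma isHomogeneousSubmodule_of_isHomogeneous [GradedAlgebra 𝓑]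
    (h : DirectSum.IsInternal (extendGrading 𝓑)) {I : Ideal B} (hI : I.IsHomogeneous 𝓑) :
    IsHomogeneousSubmodule h I := by
  intro ν b hb
  by_cases hν : extendGrading 𝓑 ν = ⊥
  · have := gradedComponent_mem h ν b
    rw [hν, Submodule.mem_bot] at this
    rw [this]
    exact I.zero_mem
  · obtain ⟨μ, rfl⟩ := exists_natCast_of_extendGrading_ne_bot hν
    rw [gradedComponent_extendGrading]
    exact hI μ hb

lemma gradedComponent_smul [GradedAlgebra 𝓑] (h : IsMultigradedModule 𝓑 ℳ) {ν₀ : Fin r → ℤ}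
    {m : M} (hm : m ∈ ℳ ν₀) (ν : Fin r → ℤ) (b : B) :
    gradedComponent h.isInternal ν (b • m) =
      gradedComponent (extendGrading_isInternal 𝓑) (ν - ν₀) b • m := by
  induction b using DirectSum.Decomposition.inductionOn 𝓑 with
  | zero => simp
  | add b b' hb hb' => rw [add_smul, map_add, map_add, add_smul, hb, hb']
  | @homogeneous μ b =>
    have h1 : (b : B) ∈ extendGrading 𝓑 (fun i => (μ i : ℤ)) := by
      rw [extendGrading_natCast]
      exact b.2
    have h2 := h.smul_mem μ ν₀ b m b.2 hm
    by_cases hν : ν = fun i => (μ i : ℤ) + ν₀ i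
    · have hν' : ν - ν₀ = fun i => (μ i : ℤ) := by
        rw [hν]
        funext i
        simp
      rw [hν', gradedComponent_of_mem _ h1, hν, gradedComponent_of_mem _ h2]
    · rw [gradedComponent_of_mem_ne _ h2 (Ne.symm hν), gradedComponent_of_mem_ne _ h1, zero_smul]
      intro hc
      refine hν (funext fun i => ?_)
      have := congrFun hc i
      simp only [Pi.sub_apply] at this
      omega

lemma IsHomogeneousSubmodule.sup_span_singleton [GradedAlgebra 𝓑] (h : IsMultigradedModule 𝓑 ℳ)
    {N : Submodule B M} (hN : IsHomogeneousSubmodule h.isInternal N) {ν₀ : Fin r → ℤ} {m : M}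
    (hm : m ∈ ℳ ν₀) : IsHomogeneousSubmodule h.isInternal (N ⊔ Submodule.span B {m}) := by
  intro ν x hx
  obtain ⟨n, hn, y, hy, rfl⟩ := Submodule.mem_sup.mp hx
  obtain ⟨b, rfl⟩ := Submodule.mem_span_singleton.mp hy
  rw [map_add, gradedComponent_smul h hm]
  exact Submodule.add_mem_sup (hN ν n hn)
    (Submodule.smul_mem _ _ (Submodule.mem_span_singleton_self m))

/-- The ideal `(N : m)` of all `b` with `b m ∈ N`. -/
def colonElement (N : Submodule B M) (m : M) : Ideal B :=
  N.comap (LinearMap.toSpanSingleton B M m)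

lemma mem_colonElement {N : Submodule B M} {m : M} {b : B} :
    b ∈ colonElement N m ↔ b • m ∈ N :=
  Iff.rfl

lemma isHomogeneous_colonElement [GradedAlgebra 𝓑] (h : IsMultigradedModule 𝓑 ℳ)
    {N : Submodule B M} (hN : IsHomogeneousSubmodule h.isInternal N) {ν₀ : Fin r → ℤ} {m : M}
    (hm : m ∈ ℳ ν₀) : (colonElement N m).IsHomogeneous 𝓑 := by
  intro μ b hb
  rw [mem_colonElement] at hb ⊢
  have h1 := hN ((fun i => (μ i : ℤ)) + ν₀) _ hb
  rwa [gradedComponent_smul h hm, add_sub_cancel_right, gradedComponent_extendGrading] at h1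

/-! ### Prime ideals for gradings by `ℕ^r` -/

/-- The decidability of equality that enters the definition of a graded algebra need not be the
one coming from the linear order. -/
lemma Ideal.IsHomogeneous.isPrime_of_linearOrder {ι : Type*} [AddCommMonoid ι] [LinearOrder ι]
    [IsOrderedCancelAddMonoid ι] [dec : DecidableEq ι] {𝓒 : ι → Submodule A B}
    [inst : GradedAlgebra 𝓒] {I : Ideal B} (hI : I.IsHomogeneous 𝓒) (htop : I ≠ ⊤)
    (hmul : ∀ (μ μ' : ι) (x y : B), x ∈ 𝓒 μ → y ∈ 𝓒 μ' → x * y ∈ I → x ∈ I ∨ y ∈ I) :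
    I.IsPrime := by
  obtain rfl : dec = LinearOrder.toDecidableEq := Subsingleton.elim _ _
  exact hI.isPrime_of_homogeneous_mem_or_mem htop
    fun {x y} ⟨μ, hμ⟩ ⟨μ', hμ'⟩ h => hmul μ μ' x y hμ hμ' h

/-- The lexicographic order makes `ℕ^r` a linearly ordered cancellative monoid, so that for
homogeneous ideals primality can be tested on homogeneous elements. -/
lemma Ideal.IsHomogeneous.isPrime_of_multigraded [inst : GradedAlgebra 𝓑] {I : Ideal B}
    (hI : I.IsHomogeneous 𝓑) (htop : I ≠ ⊤)
    (hmul : ∀ (μ μ' : Fin r → ℕ) (x y : B), x ∈ 𝓑 μ → y ∈ 𝓑 μ' → x * y ∈ I → x ∈ I ∨ y ∈ I) :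
    I.IsPrime :=
  Ideal.IsHomogeneous.isPrime_of_linearOrder (ι := Lex (Fin r → ℕ))
    (dec := inferInstanceAs (DecidableEq (Fin r → ℕ))) (𝓒 := 𝓑) (inst := inst) hI htop hmul

/-! ### Lengths of graded pieces of quotients -/

/-- The length of the degree `ν` part of `M ⧸ N`, for a homogeneous submodule `N`. -/
def quotLength [IsScalarTower A B M] (ℳ : (Fin r → ℤ) → Submodule A M) (N : Submodule B M)
    (ν : Fin r → ℤ) : ℕ∞ :=
  Module.length A ((ℳ ν).map (N.mkQ.restrictScalars A))

lemma Module.length_eq_inf_ker_add_map {V W : Type*} [AddCommGroup V] [Module A V]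
    [AddCommGroup W] [Module A W] (φ : V →ₗ[A] W) (T : Submodule A V) :
    Module.length A T =
      Module.length A (T ⊓ LinearMap.ker φ : Submodule A V) + Module.length A (T.map φ) := by
  refine Module.length_eq_add_of_exact (Submodule.inclusion inf_le_left)
    ((φ.restrict (p := T) (q := T.map φ) fun x hx => Submodule.mem_map_of_mem hx))
    (Submodule.inclusion_injective _) ?_ ?_
  · rintro ⟨_, x, hx, rfl⟩
    exact ⟨⟨x, hx⟩, rfl⟩
  · rintro ⟨x, hx⟩
    constructor
    · intro h
      exact ⟨⟨x, hx, congrArg Subtype.val h⟩, rfl⟩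
    · rintro ⟨⟨y, hy⟩, hyx⟩
      obtain rfl : y = x := congrArg Subtype.val hyx
      exact Subtype.ext hy.2

lemma Module.length_range_eq_of_ker_eq {V W W' : Type*} [AddCommGroup V] [Module A V]
    [AddCommGroup W] [Module A W] [AddCommGroup W'] [Module A W'] {f : V →ₗ[A] W}
    {g : V →ₗ[A] W'} (h : LinearMap.ker f = LinearMap.ker g) :
    Module.length A (LinearMap.range f) = Module.length A (LinearMap.range g) :=
  ((f.quotKerEquivRange.symm.trans (Submodule.quotEquivOfEq _ _ h)).trans
    g.quotKerEquivRange).length_eq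

/-- Additivity of lengths in `0 → (B ⧸ (N : m))(-ν₀) → M ⧸ N → M ⧸ (N + B m) → 0`. -/
lemma quotLength_eq_add [IsScalarTower A B M] [GradedAlgebra 𝓑] (h : IsMultigradedModule 𝓑 ℳ)
    {N : Submodule B M} (hN : IsHomogeneousSubmodule h.isInternal N) {ν₀ : Fin r → ℤ} {m : M}
    (hm : m ∈ ℳ ν₀) (ν : Fin r → ℤ) :
    quotLength ℳ N ν = quotLength (extendGrading 𝓑) (colonElement N m) (ν - ν₀) +
      quotLength ℳ (N ⊔ Submodule.span B {m}) ν := by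
  set N' := N ⊔ Submodule.span B {m} with hN'
  have hle : N ≤ N' := le_sup_left
  let q : (M ⧸ N) →ₗ[A] (M ⧸ N') := (Submodule.factor hle).restrictScalars A
  let f : extendGrading 𝓑 (ν - ν₀) →ₗ[A] (M ⧸ N) :=
    ((N.mkQ ∘ₗ LinearMap.toSpanSingleton B M m).restrictScalars A) ∘ₗ
      (extendGrading 𝓑 (ν - ν₀)).subtype
  let g : extendGrading 𝓑 (ν - ν₀) →ₗ[A] (B ⧸ colonElement N m) :=
    ((colonElement N m).mkQ.restrictScalars A) ∘ₗ (extendGrading 𝓑 (ν - ν₀)).subtype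
  have hfg : LinearMap.ker f = LinearMap.ker g := by
    ext b
    simp only [f, g, LinearMap.mem_ker, LinearMap.comp_apply, LinearMap.restrictScalars_apply,
      Submodule.mkQ_apply, Submodule.Quotient.mk_eq_zero]
    rfl
  have hg : LinearMap.range g =
      (extendGrading 𝓑 (ν - ν₀)).map ((colonElement N m).mkQ.restrictScalars A) := by
    rw [LinearMap.range_comp, Submodule.range_subtype]
  have hmap : ((ℳ ν).map (N.mkQ.restrictScalars A)).map q =
      (ℳ ν).map (N'.mkQ.restrictScalars A) := by
    rw [← Submodule.map_comp]
    rfl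
  have hf : (ℳ ν).map (N.mkQ.restrictScalars A) ⊓ LinearMap.ker q = LinearMap.range f := by
    ext x
    constructor
    · rintro ⟨⟨y, hy, rfl⟩, hyq⟩
      have hyN' : y ∈ N' := (Submodule.Quotient.mk_eq_zero N').mp hyq
      obtain ⟨n, hn, z, hz, rfl⟩ := Submodule.mem_sup.mp hyN'
      obtain ⟨b, rfl⟩ := Submodule.mem_span_singleton.mp hz
      have h1 := gradedComponent_of_mem h.isInternal hy
      rw [map_add, gradedComponent_smul h hm] at h1
      refine ⟨⟨_, gradedComponent_mem (extendGrading_isInternal 𝓑) (ν - ν₀) b⟩, ?_⟩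
      rw [← h1]
      refine (Submodule.Quotient.eq N).mpr ?_
      rw [← neg_mem_iff]
      simpa using hN ν n hn
    · rintro ⟨⟨b, hb⟩, rfl⟩
      refine ⟨⟨b • m, ?_, rfl⟩, ?_⟩
      · by_cases hν : extendGrading 𝓑 (ν - ν₀) = ⊥
        · rw [hν, Submodule.mem_bot] at hb
          rw [hb, zero_smul]
          exact Submodule.zero_mem _
        · obtain ⟨μ, hμ⟩ := exists_natCast_of_extendGrading_ne_bot hν
          rw [← hμ, extendGrading_natCast] at hb
          have h1 := h.smul_mem μ ν₀ b m hb hm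
          have h2 : ν = fun i => (μ i : ℤ) + ν₀ i := by
            funext i
            have := congrFun hμ i
            simp only [Pi.sub_apply] at this
            omega
          rw [h2]
          exact h1
      · refine (Submodule.Quotient.mk_eq_zero N').mpr ?_
        exact (le_sup_right : _ ≤ N')
          (Submodule.smul_mem _ _ (Submodule.mem_span_singleton_self m))
  rw [quotLength, Module.length_eq_inf_ker_add_map q, hmap, hf,
    Module.length_range_eq_of_ker_eq hfg, hg]
  rfl

/-! ### Prime filtrations of multigraded modules -/

/-- Among the ideals `(N : m)` with `m` homogeneous and `m ∉ N`, the maximal ones are prime. -/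
lemma exists_homogeneous_colonElement_isPrime [GradedAlgebra 𝓑] [IsNoetherianRing B]
    (h : IsMultigradedModule 𝓑 ℳ) {N : Submodule B M}
    (hN : IsHomogeneousSubmodule h.isInternal N) (htop : N ≠ ⊤) :
    ∃ (ν : Fin r → ℤ) (m : M), m ∈ ℳ ν ∧ m ∉ N ∧ (colonElement N m).IsPrime ∧
      (colonElement N m).IsHomogeneous 𝓑 := by
  have hne : ({I | ∃ (ν : Fin r → ℤ) (m : M), m ∈ ℳ ν ∧ m ∉ N ∧ I = colonElement N m} :
      Set (Ideal B)).Nonempty := by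
    obtain ⟨m, hm⟩ : ∃ m, m ∉ N := by
      by_contra! hc
      exact htop (eq_top_iff.mpr fun m _ => hc m)
    obtain ⟨s, hs⟩ := exists_sum_gradedComponent h.isInternal m
    obtain ⟨ν, -, hν⟩ : ∃ ν ∈ s, gradedComponent h.isInternal ν m ∉ N := by
      by_contra! hc
      exact hm (hs ▸ Submodule.sum_mem _ hc)
    exact ⟨_, ν, _, gradedComponent_mem h.isInternal ν m, hν, rfl⟩
  obtain ⟨_, ⟨ν, m, hm, hmN, rfl⟩, hmax⟩ := set_has_maximal_iff_noetherian.mpr ‹_› _ hne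
  have hhom := isHomogeneous_colonElement h hN hm
  refine ⟨ν, m, hm, hmN, hhom.isPrime_of_multigraded ?_ ?_, hhom⟩
  · intro hc
    have : (1 : B) ∈ colonElement N m := hc ▸ Submodule.mem_top
    rw [mem_colonElement, one_smul] at this
    exact hmN this
  · intro μ μ' x y _ hy hxy
    by_contra! hc
    refine hmax (colonElement N (y • m))
      ⟨_, _, h.smul_mem μ' ν y m hy hm, hc.2, rfl⟩ (lt_of_le_of_ne ?_ ?_)
    · intro b hb
      rw [mem_colonElement, smul_comm]
      exact N.smul_mem y hb
    · intro heq
      refine hc.1 (heq ▸ ?_)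
      rw [mem_colonElement, ← mul_smul]
      exact hxy

/-- A multigraded module has a filtration with factors `(B ⧸ P_j)(-ν_j)` for homogeneous primes
`P_j`. Its consequences are recorded in terms of the list of all `(P_j, ν_j)`; the condition on
`p` in the third conjunct says that `p` lies in the support of `M ⧸ N`. -/
theorem exists_prime_filtration [IsScalarTower A B M] [GradedAlgebra 𝓑] [IsNoetherianRing B]
    [Module.Finite B M] (h : IsMultigradedModule 𝓑 ℳ) (N : Submodule B M)
    (hN : IsHomogeneousSubmodule h.isInternal N) :
    ∃ L : List (PrimeSpectrum B × (Fin r → ℤ)),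
      (∀ x ∈ L, x.1.asIdeal.IsHomogeneous 𝓑 ∧ ∃ m : M, colonElement N m ≤ x.1.asIdeal) ∧
      (∀ (p : PrimeSpectrum B) (m : M), colonElement N m ≤ p.asIdeal → ∃ x ∈ L, x.1 ≤ p) ∧
      ∀ ν, quotLength ℳ N ν =
        (L.map fun x => quotLength (extendGrading 𝓑) x.1.asIdeal (ν - x.2)).sum := by
  induction N using WellFoundedGT.induction with
  | ind N ih =>
    by_cases htop : N = ⊤
    · subst htop
      refine ⟨[], by simp, fun p m hm => (p.2.ne_top ?_).elim, fun ν => ?_⟩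
      · exact eq_top_iff.mpr fun b _ => hm (Submodule.mem_top : b • m ∈ (⊤ : Submodule B M))
      · exact Module.length_eq_zero
    · obtain ⟨ν₀, m, hm, hmN, hprime, hhom⟩ := exists_homogeneous_colonElement_isPrime h hN htop
      have hlt : N < N ⊔ Submodule.span B {m} := by
        refine lt_of_le_of_ne le_sup_left fun hc => hmN ?_
        rw [hc]
        exact (le_sup_right : _ ≤ N ⊔ Submodule.span B {m}) (Submodule.mem_span_singleton_self m)
      obtain ⟨L, hL, hsupp, hlen⟩ := ih _ hlt (hN.sup_span_singleton h hm)
      refine ⟨(⟨colonElement N m, hprime⟩, ν₀) :: L, ?_, ?_, fun ν => ?_⟩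
      · intro x hx
        rcases List.mem_cons.mp hx with rfl | hx
        · exact ⟨hhom, m, le_rfl⟩
        · obtain ⟨h1, m', hm'⟩ := hL x hx
          exact ⟨h1, m', fun b hb => hm' (hlt.le hb)⟩
      · intro p m' hm'
        by_cases hp : colonElement N m ≤ p.asIdeal
        · exact ⟨_, List.mem_cons_self, hp⟩
        · obtain ⟨b, hb, hbp⟩ := Set.not_subset.mp hp
          obtain ⟨x, hx, hxp⟩ := hsupp p m' fun c hc => by
            obtain ⟨n, hn, z, hz, hnz⟩ := Submodule.mem_sup.mp (mem_colonElement.mp hc)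
            obtain ⟨b', rfl⟩ := Submodule.mem_span_singleton.mp hz
            have hbc : b * c ∈ colonElement N m' := by
              rw [mem_colonElement, mul_smul, ← hnz, smul_add]
              refine N.add_mem (N.smul_mem b hn) ?_
              rw [smul_comm]
              exact N.smul_mem b' hb
            exact (p.2.mem_or_mem (hm' hbc)).resolve_left hbp
          exact ⟨x, List.mem_cons_of_mem _ hx, hxp⟩
      · rw [quotLength_eq_add h hN hm, hlen, List.map_cons, List.sum_cons]

/-! ### Krull dimension and growth -/

lemma Module.length_sup_add_length_inf (S T : Submodule A M) :
    Module.length A (S ⊔ T : Submodule A M) + Module.length A (S ⊓ T : Submodule A M) =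
      Module.length A S + Module.length A T := by
  have h1 := Module.length_eq_inf_ker_add_map T.mkQ (S ⊔ T)
  have h2 := Module.length_eq_inf_ker_add_map T.mkQ S
  rw [Submodule.ker_mkQ] at h1 h2
  rw [inf_eq_right.mpr (le_sup_right : T ≤ S ⊔ T), Submodule.map_sup, Submodule.mkQ_map_self,
    sup_bot_eq] at h1
  rw [h1, h2]
  ring

lemma Module.length_biSup_le {ι : Type*} (s : Finset ι) (T : ι → Submodule A M) :
    Module.length A (⨆ i ∈ s, T i : Submodule A M) ≤ ∑ i ∈ s, Module.length A (T i) := by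
  classical
  induction s using Finset.induction_on with
  | empty =>
    have : (⨆ i ∈ (∅ : Finset ι), T i) = ⊥ := by simp
    rw [this, Module.length_bot]
    exact zero_le
  | insert i s hi ih =>
    rw [Finset.iSup_insert, Finset.sum_insert hi]
    refine le_trans ?_ (add_le_add_right ih _)
    rw [← Module.length_sup_add_length_inf]
    exact le_self_add

lemma Module.length_mono {S T : Submodule A M} (h : S ≤ T) :
    Module.length A S ≤ Module.length A T :=
  Module.length_le_of_injective (Submodule.inclusion h) (Submodule.inclusion_injective h)

/-- The sum of all graded pieces of `B` whose multidegree lies in the box `[0, k] ^ r`. -/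
def boxFiltration (𝓑 : (Fin r → ℕ) → Submodule A B) (k : ℕ) : Submodule A B :=
  ⨆ ν ∈ degreeBox r k, extendGrading 𝓑 ν

lemma mem_degreeBox {k : ℕ} {ν : Fin r → ℤ} : ν ∈ degreeBox r k ↔ ∀ i, 0 ≤ ν i ∧ ν i ≤ k := by
  simp [degreeBox]

lemma boxFiltration_mono (𝓑 : (Fin r → ℕ) → Submodule A B) : Monotone (boxFiltration 𝓑) := by
  intro k k' hk
  refine iSup₂_le fun ν hν => le_iSup₂_of_le ν ?_ le_rfl
  rw [mem_degreeBox] at hν ⊢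
  exact fun i => ⟨(hν i).1, (hν i).2.trans (by exact_mod_cast hk)⟩

lemma le_boxFiltration {k : ℕ} {μ : Fin r → ℕ} (h : ∀ i, μ i ≤ k) :
    𝓑 μ ≤ boxFiltration 𝓑 k := by
  rw [← extendGrading_natCast 𝓑 μ]
  refine le_iSup₂_of_le (f := fun ν (_ : ν ∈ degreeBox r k) => extendGrading 𝓑 ν) _ ?_ le_rfl
  rw [mem_degreeBox]
  exact fun i => ⟨by simp, by exact_mod_cast h i⟩

lemma exists_mem_boxFiltration [GradedAlgebra 𝓑] (b : B) : ∃ k, b ∈ boxFiltration 𝓑 k := by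
  induction b using DirectSum.Decomposition.inductionOn 𝓑 with
  | zero => exact ⟨0, Submodule.zero_mem _⟩
  | add b b' hb hb' =>
    obtain ⟨k, hk⟩ := hb
    obtain ⟨k', hk'⟩ := hb'
    exact ⟨max k k', Submodule.add_mem _ (boxFiltration_mono 𝓑 (le_max_left _ _) hk)
      (boxFiltration_mono 𝓑 (le_max_right _ _) hk')⟩
  | @homogeneous μ b =>
    exact ⟨∑ i, μ i, le_boxFiltration
      (fun i => Finset.single_le_sum (fun _ _ => Nat.zero_le _) (Finset.mem_univ i)) b.2⟩

lemma boxFiltration_mul_le [GradedAlgebra 𝓑] (k k' : ℕ) :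
    boxFiltration 𝓑 k * boxFiltration 𝓑 k' ≤ boxFiltration 𝓑 (k + k') := by
  simp only [boxFiltration, Submodule.iSup_mul, Submodule.mul_iSup]
  refine iSup₂_le fun ν' hν' => iSup₂_le fun ν hν => ?_
  by_cases hb : extendGrading 𝓑 ν = ⊥
  · rw [hb, Submodule.bot_mul]
    exact bot_le
  by_cases hb' : extendGrading 𝓑 ν' = ⊥
  · rw [hb', Submodule.mul_bot]
    exact bot_le
  obtain ⟨μ, rfl⟩ := exists_natCast_of_extendGrading_ne_bot hb
  obtain ⟨μ', rfl⟩ := exists_natCast_of_extendGrading_ne_bot hb'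
  rw [mem_degreeBox] at hν hν'
  rw [extendGrading_natCast, extendGrading_natCast, Submodule.mul_le]
  intro x hx y hy
  refine le_boxFiltration (μ := μ + μ') (fun i => ?_) (SetLike.mul_mem_graded hx hy)
  have h1 := (hν i).2
  have h2 := (hν' i).2
  rw [Pi.add_apply]
  omega

/-- The length of the image of the `k`-th step of the box filtration in `B ⧸ I`. -/
def filtLength (𝓑 : (Fin r → ℕ) → Submodule A B) (I : Ideal B) (k : ℕ) : ℕ∞ :=
  Module.length A ((boxFiltration 𝓑 k).map (I.mkQ.restrictScalars A))

lemma filtLength_mono (𝓑 : (Fin r → ℕ) → Submodule A B) (I : Ideal B) :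
    Monotone (filtLength 𝓑 I) := fun _ _ hk =>
  Module.length_mono (Submodule.map_mono (boxFiltration_mono 𝓑 hk))

lemma filtLength_le_sum (𝓑 : (Fin r → ℕ) → Submodule A B) (I : Ideal B) (k : ℕ) :
    filtLength 𝓑 I k ≤ ∑ ν ∈ degreeBox r k, quotLength (extendGrading 𝓑) I ν := by
  rw [filtLength, boxFiltration]
  rw [(Submodule.gc_map_comap (I.mkQ.restrictScalars A)).l_iSup₂]
  exact Module.length_biSup_le _ _

lemma one_le_filtLength [GradedAlgebra 𝓑] {I : Ideal B} (hI : I ≠ ⊤) (k : ℕ) :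
    1 ≤ filtLength 𝓑 I k := by
  refine Order.one_le_iff_pos.mpr (Module.length_pos_iff.mpr ?_)
  refine Submodule.nontrivial_iff_ne_bot.mpr fun hc => hI ?_
  rw [Ideal.eq_top_iff_one]
  have h1 : (1 : B) ∈ boxFiltration 𝓑 k :=
    le_boxFiltration (μ := 0) (fun i => Nat.zero_le _) SetLike.GradedOne.one_mem
  have h2 := Submodule.mem_map_of_mem (f := I.mkQ.restrictScalars A) h1
  rw [hc, Submodule.mem_bot] at h2
  exact (Submodule.Quotient.mk_eq_zero I).mp h2

/-- For primes `q < q'`, multiplication by an element of `q'` outside `q` embeds `B ⧸ q` into the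
kernel of `B ⧸ q → B ⧸ q'`. -/
lemma exists_filtLength_add_le [GradedAlgebra 𝓑] {q q' : PrimeSpectrum B} (h : q < q') :
    ∃ c : ℕ, ∀ k, filtLength 𝓑 q.asIdeal k + filtLength 𝓑 q'.asIdeal (k + c) ≤
      filtLength 𝓑 q.asIdeal (k + c) := by
  obtain ⟨y, hy', hy⟩ := Set.exists_of_ssubset (show (q.asIdeal : Set B) ⊂ q'.asIdeal from h)
  obtain ⟨c, hc⟩ := exists_mem_boxFiltration (𝓑 := 𝓑) y
  refine ⟨c, fun k => ?_⟩
  have hle : q.asIdeal ≤ q'.asIdeal := h.le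
  let φ : (B ⧸ q.asIdeal) →ₗ[A] (B ⧸ q'.asIdeal) :=
    (Submodule.factor hle).restrictScalars A
  let ψ : (B ⧸ q.asIdeal) →ₗ[A] (B ⧸ q.asIdeal) :=
    (LinearMap.lsmul B (B ⧸ q.asIdeal) y).restrictScalars A
  have hψ : Function.Injective ψ := by
    refine (injective_iff_map_eq_zero ψ).mpr fun x hx => ?_
    obtain ⟨b, rfl⟩ := Submodule.Quotient.mk_surjective _ x
    have h1 : y * b ∈ q.asIdeal := (Submodule.Quotient.mk_eq_zero q.asIdeal).mp hx
    exact (Submodule.Quotient.mk_eq_zero q.asIdeal).mpr ((q.2.mem_or_mem h1).resolve_left hy)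
  have hmap : ((boxFiltration 𝓑 (k + c)).map (q.asIdeal.mkQ.restrictScalars A)).map φ =
      (boxFiltration 𝓑 (k + c)).map (q'.asIdeal.mkQ.restrictScalars A) := by
    rw [← Submodule.map_comp]
    rfl
  conv_rhs => rw [filtLength, Module.length_eq_inf_ker_add_map φ, hmap]
  refine add_le_add_left ?_ _
  rw [filtLength, (Submodule.equivMapOfInjective ψ hψ _).length_eq]
  refine Module.length_mono ?_
  rintro _ ⟨_, ⟨b, hb, rfl⟩, rfl⟩
  refine ⟨⟨y * b, ?_, rfl⟩, ?_⟩
  · have h1 := boxFiltration_mul_le (𝓑 := 𝓑) c k (Submodule.mul_mem_mul hc hb)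
    rwa [add_comm] at h1
  · exact (Submodule.Quotient.mk_eq_zero q'.asIdeal).mpr (q'.asIdeal.mul_mem_right b hy')

/-- Chains of `l + 1` primes starting at `q` force growth of order at least `l`. -/
lemma exists_pow_le_filtLength [GradedAlgebra 𝓑] (l : ℕ) (q : PrimeSpectrum B)
    (hl : (l : ℕ∞) ≤ Order.coheight q) :
    ∃ a : ℕ, ∀ m : ℕ, ((m ^ l : ℕ) : ℕ∞) ≤ filtLength 𝓑 q.asIdeal (a * m) := by
  induction l generalizing q with
  | zero => exact ⟨0, fun m => by simpa using one_le_filtLength q.2.ne_top _⟩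
  | succ l ih =>
    obtain ⟨q', hq', hl'⟩ : ∃ q' > q, (l : ℕ∞) ≤ Order.coheight q' := by
      by_contra! hc
      have := hl.trans (Order.coheight_le_coe_iff.mpr hc)
      norm_cast at this
      omega
    obtain ⟨a, ha⟩ := ih q' hl'
    obtain ⟨c, hc⟩ := exists_filtLength_add_le (𝓑 := 𝓑) hq'
    -- Each of `j` steps of size `c` adds at least the length belonging to `q'`.
    have hiter : ∀ k j : ℕ, (j : ℕ∞) * filtLength 𝓑 q'.asIdeal k ≤
        filtLength 𝓑 q.asIdeal (k + j * c) := by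
      intro k j
      induction j with
      | zero => simp
      | succ j ihj =>
        have h1 := hc (k + j * c)
        have h2 := filtLength_mono 𝓑 q'.asIdeal (show k ≤ k + j * c + c by omega)
        rw [Nat.cast_succ, add_mul, one_mul, Nat.succ_mul, ← add_assoc]
        exact (add_le_add ihj h2).trans h1
    refine ⟨a + c, fun m => ?_⟩
    have h1 := hiter (a * m) m
    rw [add_mul, mul_comm c m]
    refine le_trans ?_ h1
    rw [pow_succ, mul_comm, Nat.cast_mul]
    exact mul_le_mul_right (ha m) _

/-- The dimension of `B ⧸ P` is at most the weight of any pole decomposition of its Hilbert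
function. -/
lemma coheight_le_of_hasPoles [GradedAlgebra 𝓑] {P : PrimeSpectrum B} {d : ℕ}
    {E : (Fin r → ℕ) → ℤ} (hfin : ∀ ν, quotLength (extendGrading 𝓑) P.asIdeal ν ≠ ⊤)
    (h : HasPoles d (fun ν => ((quotLength (extendGrading 𝓑) P.asIdeal ν).toNat : ℤ)) E) :
    Order.coheight P ≤ d := by
  by_contra! hd
  obtain ⟨a, ha⟩ := exists_pow_le_filtLength (𝓑 := 𝓑) (d + 1) P (by
    push_cast
    exact Order.add_one_le_of_lt hd)
  obtain ⟨C, hC⟩ := h.exists_sum_degreeBox_le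
  have hub : ∀ m : ℕ, m ^ (d + 1) ≤ C * (a * m + 1) ^ d := fun m => by
    have h1 := (ha m).trans (filtLength_le_sum 𝓑 P.asIdeal (a * m))
    have h2 : ∑ ν ∈ degreeBox r (a * m), quotLength (extendGrading 𝓑) P.asIdeal ν =
        ((∑ ν ∈ degreeBox r (a * m), (quotLength (extendGrading 𝓑) P.asIdeal ν).toNat : ℕ) :
          ℕ∞) := by
      push_cast
      exact Finset.sum_congr rfl fun ν _ => (ENat.natCast_toNat (hfin ν)).symm
    rw [h2] at h1
    have h3 : m ^ (d + 1) ≤ ∑ ν ∈ degreeBox r (a * m),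
      (quotLength (extendGrading 𝓑) P.asIdeal ν).toNat := by exact_mod_cast h1
    have h4 := hC (a * m)
    exact h3.trans (by exact_mod_cast h4)
  -- The inequality fails for `m > C (a + 1) ^ d`, as `a m + 1 ≤ (a + 1) m`.
  set m := C * (a + 1) ^ d + 1 with hm
  have h1 := hub m
  have h2 : C * (a * m + 1) ^ d ≤ C * (a + 1) ^ d * m ^ d := by
    rw [mul_assoc, ← mul_pow]
    gcongr
    rw [add_mul, one_mul]
    omega
  have h3 : m * m ^ d ≤ C * (a + 1) ^ d * m ^ d := by
    rw [← pow_succ']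
    exact h1.trans h2
  have h4 := Nat.le_of_mul_le_mul_right h3 (by positivity)
  omega

/-! ### The irrelevant ideal -/

lemma IsStandardMultigraded.subset_of_pos [GradedAlgebra 𝓑] (h𝓑 : IsStandardMultigraded 𝓑)
    {I : Ideal B} {i : Fin r} (hI : (𝓑 (Pi.single i 1) : Set B) ⊆ I) {μ : Fin r → ℕ}
    (hμ : 0 < μ i) : (𝓑 μ : Set B) ⊆ I := by
  classical
  obtain ⟨S, hS, hgen⟩ := h𝓑.generated
  have key : ∀ b : B, ∀ μ : Fin r → ℕ, 0 < μ i → (DirectSum.decompose 𝓑 b μ : B) ∈ I := by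
    intro b
    have hb : b ∈ Algebra.adjoin A (S : Set B) := hgen ▸ Algebra.mem_top
    induction hb using Algebra.adjoin_induction with
    | mem x hx =>
      intro μ hμ
      obtain ⟨j, hj⟩ := hS x hx
      by_cases hμj : Pi.single j 1 = μ
      · rw [← hμj] at hμ ⊢
        have hij : i = j := by
          by_contra hne
          simp [hne] at hμ
        subst hij
        rw [DirectSum.decompose_of_mem_same 𝓑 hj]
        exact hI hj
      · rw [DirectSum.decompose_of_mem_ne 𝓑 hj hμj]
        exact I.zero_mem
    | algebraMap a =>
      intro μ hμ
      have h0 : algebraMap A B a ∈ 𝓑 0 := (h𝓑.degree_zero _).mpr ⟨a, rfl⟩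
      rw [DirectSum.decompose_of_mem_ne 𝓑 h0 fun hc => by simp [← hc] at hμ]
      exact I.zero_mem
    | add x y _ _ hx hy =>
      intro μ hμ
      rw [DirectSum.decompose_add]
      exact I.add_mem (hx μ hμ) (hy μ hμ)
    | mul x y _ _ hx hy =>
      intro μ hμ
      rw [DirectSum.decompose_mul, DirectSum.coe_mul_apply]
      refine I.sum_mem fun μμ' hmem => ?_
      rw [← (Finset.mem_filter.mp hmem).2, Pi.add_apply] at hμ
      rcases Nat.eq_zero_or_pos (μμ'.1 i) with h0 | h0
      · exact I.mul_mem_left _ (hy _ (by omega))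
      · exact I.mul_mem_right _ (hx _ h0)
  intro b hb
  rw [← DirectSum.decompose_of_mem_same 𝓑 hb]
  exact key b μ hμ

/-- A prime contains the irrelevant ideal if and only if it contains all elements of degree `e_i`,
for some `i`. -/
lemma IsStandardMultigraded.irrelevantIdeal_le_iff [GradedAlgebra 𝓑]
    (h𝓑 : IsStandardMultigraded 𝓑) (P : PrimeSpectrum B) :
    irrelevantIdeal 𝓑 ≤ P.asIdeal ↔ ∃ i, (𝓑 (Pi.single i 1) : Set B) ⊆ P.asIdeal := by
  constructor
  · intro h
    by_contra! hc
    choose x hx hxP using fun i => Set.not_subset.mp (hc i)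
    have hprod : ∏ i, x i ∈ 𝓑 (∑ i, Pi.single i 1) :=
      SetLike.prod_mem_graded (A := 𝓑) (fun i => Pi.single i 1) x (fun i _ => hx i)
    have hN : ∏ i, x i ∈ irrelevantIdeal 𝓑 := by
      refine Ideal.subset_span ⟨_, fun i => ?_, hprod⟩
      rw [Finset.univ_sum_single (fun _ => 1)]
      exact one_pos
    obtain ⟨i, -, hi⟩ := (P.2.prod_mem_iff).mp (h hN)
    exact hxP i hi
  · rintro ⟨i, hi⟩
    exact Ideal.span_le.mpr fun b ⟨μ, hμ, hb⟩ => h𝓑.subset_of_pos hi (hμ i) hb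

/-! ### The leading form of a homogeneous prime -/

/-- `E` is the leading form of `B ⧸ P`: with `d = dim B ⧸ P`, the Hilbert series of `B ⧸ P` is
`∑ Q_n / (1 - t) ^ n`, the sum over all `|n| = d`, with `Q_n(1) = E n ≥ 0`, not all of them zero,
and `E n > 0` implies that the indices `i` with `n_i = 0` are those for which `P` contains the
degree `e_i` part of `B`. -/
structure IsLeadingForm (𝓑 : (Fin r → ℕ) → Submodule A B) (P : PrimeSpectrum B) (d : ℕ)
    (E : (Fin r → ℕ) → ℤ) : Prop where
  coheight_eq : Order.coheight P = d
  length_ne_top : ∀ ν, quotLength (extendGrading 𝓑) P.asIdeal ν ≠ ⊤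
  hasPoles : HasPoles d (fun ν => ((quotLength (extendGrading 𝓑) P.asIdeal ν).toNat : ℤ)) E
  nonneg : ∀ n, 0 ≤ E n
  exists_pos : ∃ n, 0 < E n
  eq_zero_iff : ∀ n, 0 < E n → ∀ i, n i = 0 ↔ (𝓑 (Pi.single i 1) : Set B) ⊆ P.asIdeal

lemma hasPoles_list_sum {τ : Type*} {d : ℕ} (L : List τ) (h : τ → (Fin r → ℤ) → ℕ∞)
    (E : τ → (Fin r → ℕ) → ℤ) (hfin : ∀ x ∈ L, ∀ ν, h x ν ≠ ⊤)
    (hp : ∀ x ∈ L, HasPoles d (fun ν => ((h x ν).toNat : ℤ)) (E x)) :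
    (∀ ν, (L.map fun x => h x ν).sum ≠ ⊤) ∧
      HasPoles d (fun ν => ((L.map fun x => h x ν).sum.toNat : ℤ)) (L.map E).sum := by
  induction L with
  | nil => exact ⟨by simp, HasPoles.zero⟩
  | cons x L ih =>
    obtain ⟨h1, h2⟩ := ih (fun y hy => hfin y (List.mem_cons_of_mem _ hy))
      (fun y hy => hp y (List.mem_cons_of_mem _ hy))
    have hx := hfin x List.mem_cons_self
    simp only [List.map_cons, List.sum_cons]
    refine ⟨fun ν => WithTop.add_ne_top.mpr ⟨hx ν, h1 ν⟩, ?_⟩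
    convert (hp x List.mem_cons_self).add h2 using 1
    funext ν
    rw [ENat.toNat_add (hx ν) (h1 ν)]
    simp

lemma list_sum_apply_pos_iff {τ ι : Type*} (L : List τ) (E : τ → ι → ℤ)
    (hE : ∀ x ∈ L, ∀ n, 0 ≤ E x n) (n : ι) :
    0 ≤ (L.map E).sum n ∧ (0 < (L.map E).sum n ↔ ∃ x ∈ L, 0 < E x n) := by
  induction L with
  | nil => simp
  | cons x L ih =>
    obtain ⟨h1, h2⟩ := ih fun y hy => hE y (List.mem_cons_of_mem _ hy)
    have hx := hE x List.mem_cons_self n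
    simp only [List.map_cons, List.sum_cons, Pi.add_apply, List.exists_mem_cons_iff, ← h2]
    exact ⟨by omega, by omega⟩

/-- The factors of maximal dimension of a prime filtration determine the leading form. -/
lemma exists_hasPoles_of_list {L : List (PrimeSpectrum B × (Fin r → ℤ))} (hne : L ≠ [])
    (D : PrimeSpectrum B → ℕ) (E : PrimeSpectrum B → (Fin r → ℕ) → ℤ)
    (hL : ∀ x ∈ L, IsLeadingForm 𝓑 x.1 (D x.1) (E x.1)) :
    ∃ (d : ℕ) (F : (Fin r → ℕ) → ℤ),
      (∀ ν, (L.map fun x => quotLength (extendGrading 𝓑) x.1.asIdeal (ν - x.2)).sum ≠ ⊤) ∧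
      HasPoles d (fun ν =>
        ((L.map fun x => quotLength (extendGrading 𝓑) x.1.asIdeal (ν - x.2)).sum.toNat : ℤ)) F ∧
      (∀ n, 0 ≤ F n) ∧
      (∀ n, 0 < F n ↔ ∃ x ∈ L, D x.1 = d ∧ 0 < E x.1 n) ∧
      (∀ x ∈ L, D x.1 ≤ d) ∧ ∃ x ∈ L, D x.1 = d := by
  obtain ⟨y, hy, hmax⟩ := Set.exists_max_image {x | x ∈ L} (fun x => D x.1) (List.finite_toSet L)
    (List.exists_mem_of_ne_nil L hne)
  set d := D y.1 with hd
  let G : PrimeSpectrum B × (Fin r → ℤ) → (Fin r → ℕ) → ℤ :=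
    fun x => if D x.1 = d then E x.1 else 0
  have hG : ∀ x ∈ L, HasPoles d
      (fun ν => ((quotLength (extendGrading 𝓑) x.1.asIdeal (ν - x.2)).toNat : ℤ)) (G x) := by
    intro x hx
    have h1 := (hL x hx).hasPoles.translate x.2
    by_cases hxd : D x.1 = d
    · simp only [G, if_pos hxd]
      rwa [hxd] at h1
    · -- A positive weight `d` of some leading form forces `r > 0`.
      have hlt : D x.1 < d := lt_of_le_of_ne (hmax x hx) hxd
      obtain ⟨n, hn⟩ := (hL y hy).exists_pos
      have hsum : ∑ i, n i = d := by
        by_contra hc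
        exact hn.ne' ((hL y hy).hasPoles.eq_zero_of_ne hc)
      obtain ⟨i⟩ : Nonempty (Fin r) := by
        by_contra hc
        rw [not_nonempty_iff] at hc
        rw [Finset.univ_eq_empty, Finset.sum_empty] at hsum
        omega
      simp only [G, if_neg hxd]
      exact h1.raise_of_lt i hlt
  obtain ⟨h1, h2⟩ := hasPoles_list_sum L
    (fun x ν => quotLength (extendGrading 𝓑) x.1.asIdeal (ν - x.2)) G
    (fun x hx ν => (hL x hx).length_ne_top _) hG
  have hpos := list_sum_apply_pos_iff L G fun x hx n => by
    by_cases hxd : D x.1 = d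
    · simpa only [G, if_pos hxd] using (hL x hx).nonneg n
    · simp only [G, if_neg hxd, Pi.zero_apply, le_refl]
  refine ⟨d, (L.map G).sum, h1, h2, fun n => (hpos n).1, fun n => ?_, hmax, y, hy, rfl⟩
  rw [(hpos n).2]
  refine exists_congr fun x => and_congr_right fun _ => ?_
  by_cases hxd : D x.1 = d <;> simp [G, hxd]

/-- The degree zero part of `B ⧸ P` is the residue field of `A` at the contraction of `P`. -/
lemma quotLength_zero_eq_one [IsArtinianRing A] (h𝓑 : IsStandardMultigraded 𝓑)
    (P : PrimeSpectrum B) : quotLength (extendGrading 𝓑) P.asIdeal 0 = 1 := by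
  let φ : A →ₗ[A] (B ⧸ P.asIdeal) :=
    (P.asIdeal.mkQ.restrictScalars A) ∘ₗ Algebra.linearMap A B
  have h0 : extendGrading 𝓑 0 = LinearMap.range (Algebra.linearMap A B) := by
    have h1 := extendGrading_natCast 𝓑 0
    simp only [Pi.zero_apply, Nat.cast_zero] at h1
    rw [show (0 : Fin r → ℤ) = fun _ => 0 from rfl, h1]
    ext b
    exact h𝓑.degree_zero b
  have hker : LinearMap.ker φ = P.asIdeal.comap (algebraMap A B) := by
    ext a
    exact Submodule.Quotient.mk_eq_zero P.asIdeal
  have hmax : Ideal.IsMaximal (LinearMap.ker φ) := by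
    rw [hker]
    have := P.2.comap (algebraMap A B)
    exact IsArtinianRing.isMaximal_of_isPrime _
  rw [quotLength, h0, ← LinearMap.range_comp]
  refine Eq.trans φ.quotKerEquivRange.length_eq.symm ?_
  rw [Module.length_eq_one_iff]
  exact isSimpleModule_iff_isCoatom.mpr hmax.out

/-- The case that `P` contains all elements of positive degree. -/
lemma isLeadingForm_of_forall_subset [IsArtinianRing A] [GradedAlgebra 𝓑]
    (h𝓑 : IsStandardMultigraded 𝓑) {P : PrimeSpectrum B}
    (h : ∀ i, (𝓑 (Pi.single i 1) : Set B) ⊆ P.asIdeal) :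
    IsLeadingForm 𝓑 P 0 (fun n => if n = 0 then 1 else 0) := by
  have hlen : ∀ ν, quotLength (extendGrading 𝓑) P.asIdeal ν = if ν = 0 then 1 else 0 := by
    intro ν
    split_ifs with hν
    · rw [hν, quotLength_zero_eq_one h𝓑]
    · have hsub : extendGrading 𝓑 ν ≤ P.asIdeal.restrictScalars A := by
        refine iSup₂_le fun μ hμ => ?_
        obtain ⟨i, hi⟩ : ∃ i, 0 < μ i := by
          by_contra! hc
          refine hν (hμ ▸ funext fun i => ?_)
          have := hc i
          simp only [Pi.zero_apply]
          omega
        exact h𝓑.subset_of_pos (h i) hi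
      have hbot : (extendGrading 𝓑 ν).map (P.asIdeal.mkQ.restrictScalars A) = ⊥ := by
        refine le_bot_iff.mp (Submodule.map_le_iff_le_comap.mpr fun b hb => ?_)
        exact (Submodule.Quotient.mk_eq_zero P.asIdeal).mpr (hsub hb)
      rw [quotLength, hbot, Module.length_bot]
  have hfin : ∀ ν, quotLength (extendGrading 𝓑) P.asIdeal ν ≠ ⊤ := fun ν => by
    rw [hlen]
    split_ifs <;> simp
  have hw : weightSet r ((0 : ℕ) : WithBot ℕ∞) = {0} := by
    ext n
    rw [mem_weightSet_natCast, Finset.mem_singleton]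
    simp [funext_iff]
  have hpoles : HasPoles 0
      (fun ν => ((quotLength (extendGrading 𝓑) P.asIdeal ν).toNat : ℤ))
      (fun n => if n = 0 then 1 else 0) := by
    refine ⟨⟨1, fun ν => ?_, fun n hn => ?_⟩, fun n hn => ?_⟩
    · beta_reduce
      rw [hw, Finset.sum_singleton, Pi.one_apply, fractionCoeff_eq, map_one, Module.End.one_apply,
        poleCoeff_zero, hlen]
      split_ifs <;> simp
    · rw [hw, Finset.mem_singleton] at hn
      beta_reduce
      rw [if_pos hn, evalOne_eq, Pi.one_apply, map_one]
    · rw [hw, Finset.mem_singleton] at hn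
      exact if_neg hn
  refine ⟨?_, hfin, hpoles, fun n => by split_ifs <;> simp, ⟨0, by simp⟩, fun n hn i => ?_⟩
  · exact le_antisymm (coheight_le_of_hasPoles hfin hpoles) zero_le
  · have hn0 : n = 0 := by
      by_contra hc
      simp [hc] at hn
    simp [hn0, h i]

/-- For `x ∈ B` of degree `e_i` outside `P`, the leading form of `B ⧸ P` is obtained from that of
`B ⧸ (P + x B)`, whose dimension is one less, by a shift by `e_i`. -/
lemma exists_leadingForm_of_not_subset [IsArtinianRing A] [GradedAlgebra 𝓑] [IsNoetherianRing B]
    (h𝓑 : IsStandardMultigraded 𝓑) {P : PrimeSpectrum B} (hP : P.asIdeal.IsHomogeneous 𝓑)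
    (ih : ∀ P' > P, P'.asIdeal.IsHomogeneous 𝓑 → ∃ d E, IsLeadingForm 𝓑 P' d E) {i : Fin r}
    (hi : ¬ (𝓑 (Pi.single i 1) : Set B) ⊆ P.asIdeal) :
    ∃ (d : ℕ) (E : (Fin r → ℕ) → ℤ), Order.coheight P = d ∧
      (∀ ν, quotLength (extendGrading 𝓑) P.asIdeal ν ≠ ⊤) ∧
      HasPoles d (fun ν => ((quotLength (extendGrading 𝓑) P.asIdeal ν).toNat : ℤ)) E ∧
      (∀ n, 0 ≤ E n) ∧ (∃ n, 0 < E n) ∧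
      (∀ n, 0 < E n → n i ≠ 0 ∧
        ∀ j, (𝓑 (Pi.single j 1) : Set B) ⊆ P.asIdeal → n j = 0) := by
  obtain ⟨x, hx, hxP⟩ := Set.not_subset.mp hi
  have hgr := isMultigradedModule_extendGrading (𝓑 := 𝓑)
  have hPh := isHomogeneousSubmodule_of_isHomogeneous hgr.isInternal hP
  have hx' : x ∈ extendGrading 𝓑 (Pi.single i 1) := by
    have h1 := extendGrading_natCast 𝓑 (Pi.single i 1)
    have h2 : (fun j => ((Pi.single i 1 : Fin r → ℕ) j : ℤ)) = Pi.single i 1 := by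
      funext j
      by_cases hj : j = i
      · subst hj
        simp
      · simp [hj]
    rw [h2] at h1
    rw [h1]
    exact hx
  have hcolon : colonElement P.asIdeal x = P.asIdeal := by
    ext b
    rw [mem_colonElement, smul_eq_mul, P.2.mul_mem_iff_mem_or_mem]
    exact or_iff_left hxP
  have hrec := fun ν => quotLength_eq_add hgr hPh hx' ν
  rw [hcolon] at hrec
  obtain ⟨L, hL, -, hlen⟩ := exists_prime_filtration hgr _ (hPh.sup_span_singleton hgr hx')
  simp only [hlen] at hrec
  have hLP : ∀ y ∈ L, P < y.1 := by
    intro y hy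
    obtain ⟨-, m, hm⟩ := hL y hy
    have hle : P.asIdeal ⊔ Ideal.span {x} ≤ y.1.asIdeal := fun b hb =>
      hm (Ideal.mul_mem_right m _ hb)
    refine lt_of_le_of_ne (le_sup_left.trans hle) fun hc => hxP ?_
    rw [hc]
    exact hle (Ideal.mem_sup_right (Ideal.mem_span_singleton_self x))
  have hneg : ∀ ν : Fin r → ℤ, ν i < 0 → quotLength (extendGrading 𝓑) P.asIdeal ν = 0 := by
    intro ν hν
    rw [quotLength, extendGrading_eq_bot_of_neg 𝓑 hν, Submodule.map_bot, Module.length_bot]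
  -- `P + x B` is a proper ideal, since `B ⧸ P` has length `1` in degree zero.
  have hne : L ≠ [] := by
    rintro rfl
    have h1 := hrec 0
    rw [quotLength_zero_eq_one h𝓑, hneg (0 - Pi.single i 1) (by simp)] at h1
    simp at h1
  have hchoose : ∀ P' : PrimeSpectrum B, ∃ (d : ℕ) (E : (Fin r → ℕ) → ℤ),
      P < P' → P'.asIdeal.IsHomogeneous 𝓑 → IsLeadingForm 𝓑 P' d E := by
    intro P'
    by_cases h1 : P < P' ∧ P'.asIdeal.IsHomogeneous 𝓑
    · obtain ⟨d, E, h⟩ := ih P' h1.1 h1.2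
      exact ⟨d, E, fun _ _ => h⟩
    · exact ⟨0, 0, fun h2 h3 => (h1 ⟨h2, h3⟩).elim⟩
  choose D E hDE using hchoose
  have hL' : ∀ y ∈ L, IsLeadingForm 𝓑 y.1 (D y.1) (E y.1) := fun y hy =>
    hDE y.1 (hLP y hy) (hL y hy).1
  obtain ⟨d, F, hfin, hF, hF0, hFpos, -, z, hz, hzd⟩ := exists_hasPoles_of_list hne D E hL'
  -- Finiteness of the lengths by induction on `ν_i`, as they vanish for `ν_i < 0`.
  have hfinP : ∀ ν, quotLength (extendGrading 𝓑) P.asIdeal ν ≠ ⊤ := by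
    have : ∀ (k : ℕ) (ν : Fin r → ℤ), ν i < k →
        quotLength (extendGrading 𝓑) P.asIdeal ν ≠ ⊤ := by
      intro k
      induction k with
      | zero =>
        intro ν hν
        rw [hneg ν (by exact_mod_cast hν)]
        exact ENat.zero_ne_top
      | succ k ihk =>
        intro ν hν
        rw [hrec]
        refine WithTop.add_ne_top.mpr ⟨ihk _ ?_, hfin ν⟩
        push_cast at hν
        simp only [Pi.sub_apply, Pi.single_eq_same]
        omega
    exact fun ν => this ((ν i).toNat + 1) ν (by push_cast; omega)
  have hpoles := hF.of_sub_translate i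
    (H := fun ν => ((quotLength (extendGrading 𝓑) P.asIdeal ν).toNat : ℤ))
    (fun ν => by
      rw [hrec ν, ENat.toNat_add (hfinP _) (hfin ν)]
      push_cast
      ring)
    (fun ν hν => by rw [hneg ν hν]; rfl)
  refine ⟨d + 1, _, ?_, hfinP, hpoles, fun n => ?_, ?_, fun n hn => ?_⟩
  · refine le_antisymm (coheight_le_of_hasPoles hfinP hpoles) ?_
    have h1 := Order.coheight_add_one_le (hLP z hz)
    rw [(hL' z hz).coheight_eq, hzd] at h1
    exact_mod_cast h1
  · split_ifs
    · exact le_rfl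
    · exact hF0 _
  · obtain ⟨n, hn⟩ := (hL' z hz).exists_pos
    refine ⟨n + Pi.single i 1, ?_⟩
    rw [if_neg (by simp), add_tsub_cancel_right]
    exact (hFpos n).mpr ⟨z, hz, hzd, hn⟩
  · have hni : n i ≠ 0 := fun hc => by simp [hc] at hn
    refine ⟨hni, fun j hj => ?_⟩
    rw [if_neg hni] at hn
    obtain ⟨y, hy, -, hyn⟩ := (hFpos _).mp hn
    have h1 := ((hL' y hy).eq_zero_iff _ hyn j).mpr (hj.trans (hLP y hy).le)
    have hji : j ≠ i := by
      rintro rfl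
      exact hi hj
    simpa [hji] using h1

/-- The quotient by a homogeneous prime has a leading form. -/
theorem exists_isLeadingForm [IsArtinianRing A] [GradedAlgebra 𝓑] [IsNoetherianRing B]
    (h𝓑 : IsStandardMultigraded 𝓑) (P : PrimeSpectrum B) (hP : P.asIdeal.IsHomogeneous 𝓑) :
    ∃ d E, IsLeadingForm 𝓑 P d E := by
  have hmono : StrictMono (PrimeSpectrum.asIdeal (R := B)) := fun _ _ h => h
  have := hmono.wellFoundedGT
  induction P using WellFoundedGT.induction with
  | ind P ih =>
    by_cases hall : ∀ i, (𝓑 (Pi.single i 1) : Set B) ⊆ P.asIdeal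
    · exact ⟨_, _, isLeadingForm_of_forall_subset h𝓑 hall⟩
    · obtain ⟨i, hi⟩ := not_forall.mp hall
      obtain ⟨d, E, hd, hfin, hE, h0, hpos, hzero⟩ :=
        exists_leadingForm_of_not_subset h𝓑 hP (fun P' hP' h => ih P' hP' h) hi
      refine ⟨d, E, hd, hfin, hE, h0, hpos, fun n hn j => ⟨fun hj => ?_, (hzero n hn).2 j⟩⟩
      -- The leading form does not depend on the index chosen for the reduction step.
      by_contra hj'
      obtain ⟨d', E', hd', -, hE', -, -, hzero'⟩ :=
        exists_leadingForm_of_not_subset h𝓑 hP (fun P' hP' h => ih P' hP' h) hj'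
      obtain rfl : d = d' := by
        rw [hd] at hd'
        exact_mod_cast hd'
      rw [hE.unique hE'] at hn
      exact (hzero' n hn).1 hj

/-! ### The leading form of a multigraded module -/

lemma ringKrullDim_quotient_eq_coheight (p : PrimeSpectrum B) :
    ringKrullDim (B ⧸ p.asIdeal) = (Order.coheight p : WithBot ℕ∞) := by
  rw [ringKrullDim_quotient, Order.coheight_eq_krullDim_Ici]
  have h : PrimeSpectrum.zeroLocus (p.asIdeal : Set B) = Set.Ici p := by
    ext q
    rfl
  rw [h]

lemma mem_support_iff_exists_colonElement (p : PrimeSpectrum B) :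
    p ∈ Module.support B M ↔ ∃ m : M, colonElement ⊥ m ≤ p.asIdeal := by
  rw [Module.mem_support_iff_exists_annihilator]
  refine exists_congr fun m => ?_
  have h : (Submodule.span B {m}).annihilator = colonElement ⊥ m := by
    ext b
    rw [Submodule.mem_annihilator_span_singleton]
    rfl
  rw [h]

/-- The dimension of a module is the maximal dimension of `B ⧸ P`, if every prime of its support
contains one of the primes `P` of a list of elements of the support. -/
lemma supportDim_eq_of_list {τ : Type*} {L : List τ} {P : τ → PrimeSpectrum B} {d : ℕ}
    (hL : ∀ x ∈ L, P x ∈ Module.support B M)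
    (hsupp : ∀ p ∈ Module.support B M, ∃ x ∈ L, P x ≤ p)
    (hle : ∀ x ∈ L, Order.coheight (P x) ≤ d) (hex : ∃ x ∈ L, Order.coheight (P x) = d) :
    Module.supportDim B M = d := by
  refine le_antisymm (iSup_le fun s => ?_) ?_
  · obtain ⟨x, hx, hxs⟩ := hsupp _ s.head.2
    let s' : LTSeries (PrimeSpectrum B) := s.map Subtype.val fun _ _ h => h
    have h1 : (s'.length : ℕ∞) ≤ d :=
      (Order.length_le_coheight (p := s') (x := P x) hxs).trans (hle x hx)
    have h2 : s.length ≤ d := by exact_mod_cast h1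
    exact_mod_cast h2
  · obtain ⟨x, hx, hxd⟩ := hex
    have h1 : ((Order.coheight (P x) : ℕ∞) : WithBot ℕ∞) ≤ Module.supportDim B M := by
      rw [Order.coheight_eq_krullDim_Ici]
      exact Order.krullDim_le_of_strictMono
        (fun q : Set.Ici (P x) => (⟨q, Module.mem_support_mono q.2 (hL x hx)⟩ :
          Module.support B M)) fun _ _ h => h
    rw [hxd] at h1
    exact_mod_cast h1

lemma quotLength_bot [IsScalarTower A B M] (ν : Fin r → ℤ) :
    quotLength (B := B) ℳ ⊥ ν = Module.length A (ℳ ν) := by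
  refine ((Submodule.equivMapOfInjective ((⊥ : Submodule B M).mkQ.restrictScalars A)
    (LinearMap.ker_eq_bot.mp ?_) (ℳ ν)).length_eq).symm
  ext m
  exact Submodule.Quotient.mk_eq_zero ⊥

/-- For a nonzero module, the Hilbert series has a decomposition whose leading form `E` is
nonnegative and detects, by its positive values at vectors `n` with a zero entry, the primes of
maximal dimension in the support that contain the irrelevant ideal. -/
theorem exists_module_leadingForm [IsArtinianRing A] [GradedAlgebra 𝓑] [IsScalarTower A B M]
    [Module.Finite B M] [Nontrivial M] (h𝓑 : IsStandardMultigraded 𝓑)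
    (hℳ : IsMultigradedModule 𝓑 ℳ) :
    ∃ (d : ℕ) (E : (Fin r → ℕ) → ℤ), Module.supportDim B M = d ∧
      (∀ ν, Module.length A (ℳ ν) ≠ ⊤) ∧
      HasPoles d (fun ν => (hilbertFunction ℳ ν : ℤ)) E ∧
      ((∃ n, 0 < E n ∧ ∃ i, n i = 0) ↔
        ∃ p : PrimeSpectrum B, p ∈ Module.support B M ∧ Order.coheight p = d ∧
          irrelevantIdeal 𝓑 ≤ p.asIdeal) := by
  obtain ⟨S, -, hS⟩ := h𝓑.generated
  have : Algebra.FiniteType A B := ⟨⟨S, hS⟩⟩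
  have : IsNoetherianRing B := Algebra.FiniteType.isNoetherianRing A B
  have hbot : IsHomogeneousSubmodule (B := B) hℳ.isInternal ⊥ := fun ν m hm => by
    rw [(Submodule.mem_bot B).mp hm, map_zero]
    exact Submodule.zero_mem _
  obtain ⟨L, hL, hsupp, hlen⟩ := exists_prime_filtration hℳ ⊥ hbot
  have hLsupp : ∀ x ∈ L, x.1 ∈ Module.support B M := fun x hx =>
    (mem_support_iff_exists_colonElement x.1).mpr (hL x hx).2
  have hsupp' : ∀ p ∈ Module.support B M, ∃ x ∈ L, x.1 ≤ p := fun p hp => by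
    obtain ⟨m, hm⟩ := (mem_support_iff_exists_colonElement p).mp hp
    exact hsupp p m hm
  have hne : L ≠ [] := by
    rintro rfl
    obtain ⟨p, hp⟩ := Module.nonempty_support_of_nontrivial (R := B) (M := M)
    obtain ⟨x, hx, -⟩ := hsupp' p hp
    simp at hx
  have hchoose : ∀ P : PrimeSpectrum B, ∃ (d : ℕ) (E : (Fin r → ℕ) → ℤ),
      P.asIdeal.IsHomogeneous 𝓑 → IsLeadingForm 𝓑 P d E := by
    intro P
    by_cases h : P.asIdeal.IsHomogeneous 𝓑
    · obtain ⟨d, E, hE⟩ := exists_isLeadingForm h𝓑 P h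
      exact ⟨d, E, fun _ => hE⟩
    · exact ⟨0, 0, fun h' => (h h').elim⟩
  choose D E hDE using hchoose
  have hlead : ∀ x ∈ L, IsLeadingForm 𝓑 x.1 (D x.1) (E x.1) := fun x hx => hDE x.1 (hL x hx).1
  obtain ⟨d, F, hfin, hF, -, hFpos, hmax, y, hy, hyd⟩ := exists_hasPoles_of_list hne D E hlead
  simp only [← hlen, quotLength_bot] at hfin hF
  refine ⟨d, F, supportDim_eq_of_list hLsupp hsupp' ?_ ⟨y, hy, ?_⟩, hfin, hF, ?_, ?_⟩
  · intro x hx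
    rw [(hlead x hx).coheight_eq]
    exact_mod_cast hmax x hx
  · rw [(hlead y hy).coheight_eq, hyd]
  · rintro ⟨n, hn, i, hi⟩
    obtain ⟨x, hx, hxd, hxn⟩ := (hFpos n).mp hn
    refine ⟨x.1, hLsupp x hx, by rw [(hlead x hx).coheight_eq, hxd], ?_⟩
    exact (h𝓑.irrelevantIdeal_le_iff x.1).mpr ⟨i, ((hlead x hx).eq_zero_iff n hxn i).mp hi⟩
  · rintro ⟨p, hp, hpd, hpN⟩
    obtain ⟨x, hx, hxp⟩ := hsupp' p hp
    -- A proper inclusion would give a chain of primes of length `d + 1` over `x.1`.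
    obtain rfl : x.1 = p := by
      by_contra hxp'
      have h1 := Order.coheight_add_one_le (lt_of_le_of_ne hxp hxp')
      rw [hpd, (hlead x hx).coheight_eq] at h1
      have h2 : d + 1 ≤ D x.1 := by exact_mod_cast h1
      have h3 := hmax x hx
      omega
    have hxd : D x.1 = d := by
      rw [(hlead x hx).coheight_eq] at hpd
      exact_mod_cast hpd
    obtain ⟨i, hi⟩ := (h𝓑.irrelevantIdeal_le_iff x.1).mp hpN
    obtain ⟨n, hn⟩ := (hlead x hx).exists_pos
    exact ⟨n, (hFpos n).mpr ⟨x, hx, hxd, hn⟩, i, ((hlead x hx).eq_zero_iff n hn i).mpr hi⟩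

end

section Multiplicities

variable {A B M : Type*} [CommRing A] [CommRing B] {r : ℕ} [AddCommGroup M] [Module A M]
  [Module B M] {ℳ : (Fin r → ℤ) → Submodule A M}

/-! ### Mixed multiplicities and the multiplicity of the total grading -/

lemma HasPoles.of_isHilbertDecomposition {d : ℕ} {Q : (Fin r → ℕ) → MultiLaurent r}
    (hd : Module.supportDim B M = d) (hQ : IsHilbertDecomposition B ℳ Q) :
    HasPoles d (fun ν => (hilbertFunction ℳ ν : ℤ))
      (fun n => if n ∈ weightSet r (d : WithBot ℕ∞) then (Q n).evalOne else 0) := by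
  rw [IsHilbertDecomposition, hd] at hQ
  exact ⟨⟨Q, hQ, fun n hn => (if_pos hn).symm⟩, fun n hn => if_neg hn⟩

lemma shiftOne_mem_weightSet {d : WithBot ℕ∞} {n : Fin r → ℤ} (hn : n ∈ mixedTypes r d) :
    shiftOne n ∈ weightSet r d :=
  mem_weightSet.mpr (mem_mixedTypes.mp hn).2

lemma shiftOne_natCast_sub_one (n : Fin r → ℕ) : shiftOne (fun i => (n i : ℤ) - 1) = n := by
  funext i
  simp [shiftOne]

lemma mixedMultiplicity_eq {d : ℕ} {E : (Fin r → ℕ) → ℤ} (hd : Module.supportDim B M = d)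
    (hE : HasPoles d (fun ν => (hilbertFunction ℳ ν : ℤ)) E) {n : Fin r → ℤ}
    (hn : n ∈ mixedTypes r (d : WithBot ℕ∞)) : mixedMultiplicity B ℳ n = E (shiftOne n) := by
  have hex : ∃ Q, IsHilbertDecomposition B ℳ Q := by
    obtain ⟨⟨Q, hQ, -⟩, -⟩ := hE
    refine ⟨Q, ?_⟩
    rw [IsHilbertDecomposition, hd]
    exact hQ
  rw [← hd] at hn
  rw [mixedMultiplicity, dif_pos ⟨hex, hn⟩]
  rw [(hE.unique (HasPoles.of_isHilbertDecomposition hd hex.choose_spec))]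
  have := shiftOne_mem_weightSet hn
  rw [hd] at this
  exact (if_pos this).symm

lemma sum_mixedMultiplicity_eq {d : ℕ} {E : (Fin r → ℕ) → ℤ} (hd : Module.supportDim B M = d)
    (hE : HasPoles d (fun ν => (hilbertFunction ℳ ν : ℤ)) E) :
    ∑ n ∈ mixedTypes r (Module.supportDim B M), mixedMultiplicity B ℳ n =
      ∑ n ∈ weightSet r (d : WithBot ℕ∞), E n := by
  rw [hd]
  calc ∑ n ∈ mixedTypes r (d : WithBot ℕ∞), mixedMultiplicity B ℳ n
      = ∑ n ∈ mixedTypes r (d : WithBot ℕ∞), E (shiftOne n) :=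
        Finset.sum_congr rfl fun n hn => mixedMultiplicity_eq hd hE hn
    _ = ∑ n ∈ weightSet r (d : WithBot ℕ∞), E n := by
        rw [mixedTypes, Finset.sum_image]
        · simp only [shiftOne_natCast_sub_one]
        · intro n _ n' _ h
          rw [← shiftOne_natCast_sub_one n, ← shiftOne_natCast_sub_one n']
          exact congrArg shiftOne h

lemma Module.length_biSup_of_iSupIndep {ι : Type*} {T : ι → Submodule A M} (hT : iSupIndep T)
    (s : Finset ι) :
    Module.length A (⨆ i ∈ s, T i : Submodule A M) = ∑ i ∈ s, Module.length A (T i) := by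
  classical
  induction s using Finset.induction_on with
  | empty =>
    have : (⨆ i ∈ (∅ : Finset ι), T i) = ⊥ := by simp
    rw [this, Module.length_bot, Finset.sum_empty]
  | insert i s hi ih =>
    have hdisj : T i ⊓ ⨆ j ∈ s, T j = ⊥ := by
      refine ((hT i).mono_right (iSup₂_le fun j hj => ?_)).eq_bot
      exact le_iSup₂_of_le (f := fun j (_ : j ≠ i) => T j) j (fun hji => hi (hji ▸ hj)) le_rfl
    have h1 := Module.length_sup_add_length_inf (T i) (⨆ j ∈ s, T j)
    rw [hdisj, Module.length_bot, add_zero] at h1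
    rw [Finset.iSup_insert, Finset.sum_insert hi, h1, ih]

lemma hilbertFunction_eq_zero_iff {ν : Fin r → ℤ} (hfin : Module.length A (ℳ ν) ≠ ⊤) :
    hilbertFunction ℳ ν = 0 ↔ ℳ ν = ⊥ := by
  rw [hilbertFunction, ENat.toNat_eq_zero, or_iff_left hfin, Module.length_eq_zero_iff,
    Submodule.subsingleton_iff_eq_bot]

lemma toNat_length_biSup (hT : iSupIndep ℳ) (hfin : ∀ ν, Module.length A (ℳ ν) ≠ ⊤)
    (s : Finset (Fin r → ℤ)) :
    (Module.length A (⨆ ν ∈ s, ℳ ν : Submodule A M)).toNat = ∑ ν ∈ s, hilbertFunction ℳ ν := by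
  rw [Module.length_biSup_of_iSupIndep hT]
  have h : ∑ ν ∈ s, Module.length A (ℳ ν) = ((∑ ν ∈ s, hilbertFunction ℳ ν : ℕ) : ℕ∞) := by
    push_cast
    exact Finset.sum_congr rfl fun ν _ => (ENat.natCast_toNat (hfin ν)).symm
  rw [h, ENat.toNat_natCast]

/-- Setting all `t_i` equal to `t` turns a decomposition of the Hilbert series into
`∑ Q_n(t, …, t) / (1 - t) ^ d`, which yields the multiplicity of the total grading. -/
lemma gradedMultiplicity_totalGrading_eq {d : ℕ} {E : (Fin r → ℕ) → ℤ}
    (hint : DirectSum.IsInternal ℳ) (hd : Module.supportDim B M = d)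
    (hfin : ∀ ν, Module.length A (ℳ ν) ≠ ⊤)
    (hE : HasPoles d (fun ν => (hilbertFunction ℳ ν : ℤ)) E) :
    gradedMultiplicity B (totalGrading ℳ) = ∑ n ∈ weightSet r (d : WithBot ℕ∞), (E n : ℚ) := by
  have hindep := hint.submodule_iSupIndep
  cases d with
  | zero =>
    rw [gradedMultiplicity, if_pos (by rw [hd]; exact le_rfl)]
    obtain ⟨s, hs, hsum⟩ := hE.exists_sum_eq_of_zero
    have htop : (⨆ ν ∈ s, ℳ ν) = ⊤ := by
      rw [eq_top_iff, ← hint.submodule_iSup_eq_top]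
      refine iSup_le fun ν => ?_
      by_cases hν : ν ∈ s
      · exact le_iSup₂_of_le (f := fun ν (_ : ν ∈ s) => ℳ ν) ν hν le_rfl
      · rw [(hilbertFunction_eq_zero_iff (hfin ν)).mp (by exact_mod_cast hs ν hν)]
        exact bot_le
    have h1 := toNat_length_biSup hindep hfin s
    rw [htop, Module.length_top] at h1
    rw [h1]
    exact_mod_cast hsum
  | succ d =>
    obtain ⟨P, hP, c₀, hc₀⟩ := hE.exists_totalDegree_polynomial
    obtain ⟨c₁, hc₁⟩ := hE.exists_lower_bound
    have hPoly : IsHilbertPolynomial (totalGrading ℳ) P := by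
      filter_upwards [hc₀ (min c₀ c₁) (min_le_left _ _)] with k hk
      rw [← hk]
      have htot : totalGrading ℳ k = ⨆ ν ∈ totalDegreeSet r (min c₀ c₁) k, ℳ ν := by
        refine le_antisymm (iSup_le fun ν => ?_) (iSup₂_le fun ν hν => ?_)
        · by_cases hν : ∀ i, min c₀ c₁ ≤ ν.1 i
          · exact le_iSup₂_of_le (f := fun ν (_ : ν ∈ totalDegreeSet r (min c₀ c₁) k) => ℳ ν)
              ν.1 (mem_totalDegreeSet.mpr ⟨ν.2, hν⟩) le_rfl
          · push Not at hν
            obtain ⟨i, hi⟩ := hν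
            rw [(hilbertFunction_eq_zero_iff (hfin ν)).mp
              (by exact_mod_cast hc₁ ν ⟨i, hi.trans_le (min_le_right _ _)⟩)]
            exact bot_le
        · exact le_iSup (fun ν : {ν : Fin r → ℤ // ∑ i, ν i = k} => ℳ ν)
            ⟨ν, (mem_totalDegreeSet.mp hν).1⟩
      rw [hilbertFunction, htot, toNat_length_biSup hindep hfin]
      push_cast
      rfl
    have hex : ∃ P, IsHilbertPolynomial (totalGrading ℳ) P := ⟨P, hPoly⟩
    have hunique : hex.choose = P := by
      have hev := hex.choose_spec.and hPoly
      obtain ⟨K, hK⟩ := Filter.eventually_atTop.mp hev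
      refine Polynomial.eq_of_infinite_eval_eq _ _ (Set.Infinite.mono ?_
        ((Set.Ici_infinite K).image (f := fun k : ℤ => (k : ℚ)) Int.cast_injective.injOn))
      rintro _ ⟨k, hk, rfl⟩
      exact (hK k hk).1.symm.trans (hK k hk).2
    have hnot : ¬ Module.supportDim B M ≤ 0 := by
      rw [hd]
      intro hc
      have : d + 1 ≤ 0 := by exact_mod_cast hc
      omega
    rw [gradedMultiplicity, if_neg hnot, dif_pos hex, hunique, ← hP, hd]
    rfl

end Multiplicities

theorem mainTheorem6 {A B M : Type*} [CommRing A] [IsLocalRing A] [IsArtinianRing A]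
    [CommRing B] [Algebra A B] {r : ℕ} (𝓑 : (Fin r → ℕ) → Submodule A B) [GradedAlgebra 𝓑]
    (h𝓑 : IsStandardMultigraded 𝓑)
    [AddCommGroup M] [Module A M] [Module B M] [IsScalarTower A B M] [Module.Finite B M]
    (ℳ : (Fin r → ℤ) → Submodule A M) (hℳ : IsMultigradedModule 𝓑 ℳ) :
    -- the mixed multiplicities are well defined
    ((∃ Q, IsHilbertDecomposition B ℳ Q) ∧
      (∀ Q, IsHilbertDecomposition B ℳ Q → ∀ n ∈ mixedTypes r (Module.supportDim B M),
        mixedMultiplicity B ℳ n = (Q (shiftOne n)).evalOne)) ∧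
    -- (i)
    gradedMultiplicity B (totalGrading ℳ) =
      ∑ n ∈ mixedTypes r (Module.supportDim B M), (mixedMultiplicity B ℳ n : ℚ) ∧
    -- (ii)
    ((∃ n : Fin r → ℤ, (∀ i, -1 ≤ n i) ∧
        Module.supportDim B M ≤ ((∑ i, shiftOne n i : ℕ) : WithBot ℕ∞) ∧
        ¬ (∀ i, 0 ≤ n i) ∧ 0 < mixedMultiplicity B ℳ n) ↔
      ∃ p : PrimeSpectrum B, p ∈ Module.support B M ∧
        ringKrullDim (B ⧸ p.asIdeal) = Module.supportDim B M ∧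
        irrelevantIdeal 𝓑 ≤ p.asIdeal) := by
  rcases subsingleton_or_nontrivial M with hM | hM
  · -- For `M = 0` the dimension is `⊥`, and all sums are empty.
    have hd : Module.supportDim B M = ⊥ := Module.supportDim_eq_bot_of_subsingleton B M
    have hw : weightSet r ⊥ = ∅ := by
      ext n
      rw [mem_weightSet]
      simp only [Finset.notMem_empty, iff_false]
      exact WithBot.coe_ne_bot (a := ((∑ i, n i : ℕ) : ℕ∞))
    have ht : mixedTypes r ⊥ = ∅ := by rw [mixedTypes, hw, Finset.image_empty]
    refine ⟨⟨⟨0, fun ν => ?_⟩, fun Q _ n hn => ?_⟩, ?_, ?_⟩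
    · rw [hd, hw, Finset.sum_empty, hilbertFunction, Module.length_eq_zero]
      rfl
    · rw [hd, ht] at hn
      simp at hn
    · rw [hd, ht, Finset.sum_empty, gradedMultiplicity, if_pos (by rw [hd]; exact bot_le),
        Module.length_eq_zero]
      simp
    · constructor
      · rintro ⟨n, -, -, -, hn⟩
        rw [mixedMultiplicity, dif_neg (by rw [hd, ht]; simp)] at hn
        exact (lt_irrefl _ hn).elim
      · rintro ⟨p, hp, -⟩
        rw [Module.support_eq_empty] at hp
        exact hp.elim
  · obtain ⟨d, E, hd, hfin, hE, hiff⟩ := exists_module_leadingForm h𝓑 hℳ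
    refine ⟨⟨?_, fun Q hQ n hn => ?_⟩, ?_, ?_⟩
    · obtain ⟨⟨Q, hQ, -⟩, -⟩ := hE
      refine ⟨Q, ?_⟩
      rw [IsHilbertDecomposition, hd]
      exact hQ
    · rw [hd] at hn
      rw [mixedMultiplicity_eq hd (HasPoles.of_isHilbertDecomposition hd hQ) hn]
      exact if_pos (shiftOne_mem_weightSet hn)
    · rw [gradedMultiplicity_totalGrading_eq hℳ.isInternal hd hfin hE]
      exact_mod_cast (sum_mixedMultiplicity_eq hd hE).symm
    · simp only [ringKrullDim_quotient_eq_coheight]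
      have hco : ∀ p : PrimeSpectrum B, ((Order.coheight p : ℕ∞) : WithBot ℕ∞) =
          Module.supportDim B M ↔ Order.coheight p = d := fun p => by
        rw [hd]
        exact ⟨fun h => by exact_mod_cast h, fun h => by exact_mod_cast h⟩
      simp only [hco]
      rw [← hiff]
      constructor
      · rintro ⟨n, hn, -, hneg, hpos⟩
        have hmem : n ∈ mixedTypes r (d : WithBot ℕ∞) := by
          by_contra hc
          rw [mixedMultiplicity, dif_neg (by rw [hd]; exact fun h => hc h.2)] at hpos
          exact (lt_irrefl _ hpos).elim
        rw [mixedMultiplicity_eq hd hE hmem] at hpos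
        push Not at hneg
        obtain ⟨i, hi⟩ := hneg
        exact ⟨shiftOne n, hpos, i, by simp only [shiftOne]; omega⟩
      · rintro ⟨m, hm, i, hi⟩
        have hmem : m ∈ weightSet r (d : WithBot ℕ∞) := by
          by_contra hc
          exact hm.ne' (hE.2 m hc)
        have hmem' : (fun i => (m i : ℤ) - 1) ∈ mixedTypes r (d : WithBot ℕ∞) :=
          Finset.mem_image_of_mem _ hmem
        refine ⟨fun i => (m i : ℤ) - 1, fun i => by dsimp only; omega, ?_, fun hc => ?_, ?_⟩
        · rw [shiftOne_natCast_sub_one, hd, mem_weightSet.mp hmem]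
        · have := hc i
          simp [hi] at this
        · rw [mixedMultiplicity_eq hd hE hmem', shiftOne_natCast_sub_one]
          exact hm
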